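/- Let $a_n>0$ and $b_n\in\mathbb R$ ($n=0,1,2,\dots$) satisfy $\sum_{n=0}^\infty(|a_n-\tfrac12|+|b_n|)<\infty$, put $a_{-1}=\tfrac12$, and let $H$ be the bounded self-adjoint Jacobi operator in $\ell^2(\mathbb Z_+)$, $$He_n=a_{n-1}e_{n-1}+b_ne_n+a_ne_{n+1}\quad(n\ge 0,\ e_{-1}:=0),$$ where $\{e_n\}$ is the canonical basis. Let $E(\lambda)$ be the spectral family of $H$, and let $P_n$ be the polynomials given by $P_{-1}=0$, $P_0=1$ and $a_{n-1}P_{n-1}(z)+b_nP_n(z)+a_nP_{n+1}(z)=zP_n(z)$, $n\ge0$. For $z\in\mathbb C\setminus[-1,1]$ let $\zeta(z)=z-\sqrt{z^2-1}$ with the analytic branch that is positive for $z>1$, and put $\rho_n=\sum_{m\ge n}(|a_m-\tfrac12|+|b_m|)$. Then there is exactly one solution $\{f_n(z)\}_{n=-1}^\infty$ (the Jost solution) of $a_{n-1}u_{n-1}+b_nu_n+a_nu_{n+1}=zu_n$, $n\ge0$, such that $f_n(z)=\zeta(z)^n(1+O(\rho_n))$ as $n\to\infty$. Let $\Omega(z)=-2\zeta(z)\{P(z),f(z)\}$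 be the Jost function, where $\{P,f\}=a_n(P_nf_{n+1}-P_{n+1}f_n)$ is the Wronskian, which does not depend on $n\ge-1$. For $\lambda\in(-1,1)$ the boundary value $\Omega(\lambda+i0)$ from the upper half-plane exists and is non-zero. Moreover: 1. The spectrum of $H$ is absolutely continuous on $(-1,1)$, that is, for every $x\in\ell^2(\mathbb Z_+)$ the measure $d(E(\lambda)x,x)$ is absolutely continuous with respect to Lebesgue measure on $(-1,1)$. 2. For all $n,m\in\mathbb Z_+$ and all $\lambda\in(-1,1)$, $$\frac{d(E(\lambda)e_n,e_m)}{d\lambda}=\frac2\pi\sqrt{1-\lambda^2}\,|\Omega(\lambda+i0)|^{-2}P_n(\lambda)P_m(\lambda).$$ 3. On $(-1,1)$ the spectral measure $d\rho(\lambda)=d(E(\lambda)e_0,e_0)$ equals $w(\lambda)\,d\lambda$ with the weight $w(\lambda)=\frac2\pi\sqrt{1-\lambda^2}\,|\Omega(\lambda+i0)|^{-2}$. In particular, for the free operator $H_0$ ($a_n=\tfrac12$, $b_n=0$ for all $n$) the weight is $w_0(\lambda)=\frac2\pi\sqrt{1-\lambda^2}$. -/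

import Mathlib

open Filter Topology MeasureTheory Set Polynomial

noncomputable section

/-! ### The Jacobi operator in `ℓ²(ℤ₊)` -/

/-- The Hilbert space `ℓ²(ℤ₊)` of complex sequences. -/
abbrev EllTwo : Type := lp (fun _ : ℕ => ℂ) 2

/-- The canonical basis vector `e_n`. -/
def basisVec (n : ℕ) : EllTwo := lp.single 2 n 1

theorem weighted_sum_le (c : ℕ → ℝ) (σ : ℕ → ℕ) (C : ℝ) (hc : ∀ n, |c n| ≤ C)
    (hσ : InjOn σ {n | c n ≠ 0}) (u : EllTwo) (s : Finset ℕ) :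
    ∑ n ∈ s, ‖(c n : ℂ) * u (σ n)‖ ^ (2 : ENNReal).toReal
      ≤ (C * ‖u‖) ^ (2 : ENNReal).toReal := by
  classical
  have h2 : (0 : ℝ) < (2 : ENNReal).toReal := by norm_num
  have hC : 0 ≤ C := (abs_nonneg _).trans (hc 0)
  have h1 : ∑ n ∈ s, ‖(c n : ℂ) * u (σ n)‖ ^ (2 : ENNReal).toReal
      ≤ ∑ n ∈ s with c n ≠ 0,
          C ^ (2 : ENNReal).toReal * ‖u (σ n)‖ ^ (2 : ENNReal).toReal := by
    rw [Finset.sum_filter]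
    refine Finset.sum_le_sum fun n _ => ?_
    split_ifs with h
    · rw [norm_mul, Real.mul_rpow (norm_nonneg _) (norm_nonneg _)]
      gcongr
      simpa using hc n
    · have : c n = 0 := by simpa using h
      simp [this]
  refine h1.trans ?_
  rw [← Finset.mul_sum, Real.mul_rpow hC (norm_nonneg _)]
  refine mul_le_mul_of_nonneg_left ?_ (by positivity)
  have hinj : InjOn σ (s.filter fun n => c n ≠ 0 : Finset ℕ) :=
    hσ.mono fun n hn => by simpa using (Finset.mem_filter.1 (Finset.mem_coe.1 hn)).2
  rw [← Finset.sum_image (f := fun m => ‖u m‖ ^ (2 : ENNReal).toReal) hinj]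
  exact lp.sum_rpow_le_norm_rpow h2 u _

/-- The bounded operator `(W u)_n = c_n u_{σ(n)}` in `ℓ²(ℤ₊)`, for bounded `c` and `σ` injective
on the support of `c`. -/
def weightedComp (c : ℕ → ℝ) (σ : ℕ → ℕ) (C : ℝ) (hc : ∀ n, |c n| ≤ C)
    (hσ : InjOn σ {n | c n ≠ 0}) : EllTwo →L[ℂ] EllTwo :=
  LinearMap.mkContinuous
    { toFun := fun u => ⟨fun n => (c n : ℂ) * u (σ n),
        memℓp_gen' (weighted_sum_le c σ C hc hσ u)⟩
      map_add' := fun u v => by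
        ext n
        exact mul_add _ _ _
      map_smul' := fun k u => by
        ext n
        simp [mul_left_comm] }
    C
    (fun u => lp.norm_le_of_forall_sum_le (by norm_num)
      (mul_nonneg ((abs_nonneg _).trans (hc 0)) (norm_nonneg _))
      (weighted_sum_le c σ C hc hσ u))

open Classical in
/-- The Jacobi operator with off-diagonal entries `a_n` and diagonal entries `b_n`,
`(H u)_n = a_{n-1} u_{n-1} + b_n u_n + a_n u_{n+1}` where the first summand is absent for `n = 0`.
It is only used for bounded coefficients (the value for unbounded ones is a dummy). -/
def jacobiOperator (a b : ℕ → ℝ) : EllTwo →L[ℂ] EllTwo :=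
  if h : ∃ C, ∀ n, |a n| ≤ C ∧ |b n| ≤ C then
    weightedComp (fun n => if n = 0 then 0 else a (n - 1)) (fun n => n - 1) h.choose
        (fun n => by
          split_ifs
          · simpa using (abs_nonneg _).trans (h.choose_spec 0).1
          · exact (h.choose_spec _).1)
        (fun m hm n hn hmn => by
          have hm' : m ≠ 0 := by rintro rfl; simp at hm
          have hn' : n ≠ 0 := by rintro rfl; simp at hn
          simp only at hmn
          omega)
      + weightedComp b id h.choose (fun n => (h.choose_spec n).2) (injOn_id _)
      + weightedComp a (fun n => n + 1) h.choose (fun n => (h.choose_spec n).1)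
        (fun m _ n _ hmn => by simpa using hmn)
  else 0

/-- For bounded coefficients, `jacobiOperator a b` acts by the Jacobi matrix. -/
theorem jacobiOperator_apply (a b : ℕ → ℝ) (h : ∃ C, ∀ n, |a n| ≤ C ∧ |b n| ≤ C)
    (u : EllTwo) (n : ℕ) :
    jacobiOperator a b u n
      = (if n = 0 then 0 else (a (n - 1) : ℂ) * u (n - 1)) + b n * u n + a n * u (n + 1) := by
  rw [jacobiOperator, dif_pos h]
  by_cases hn : n = 0
  · subst hn
    change ((if (0 : ℕ) = 0 then (0 : ℝ) else a (0 - 1) : ℝ) : ℂ) * u (0 - 1) + b 0 * u 0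
      + a 0 * u (0 + 1) = _
    simp
  · change ((if n = 0 then (0 : ℝ) else a (n - 1) : ℝ) : ℂ) * u (n - 1) + b n * u n
      + a n * u (n + 1) = _
    simp [hn]

/-! ### The spectral family of a self-adjoint operator -/

section SpectralFamily

variable {E : Type*} [NormedAddCommGroup E] [InnerProductSpace ℂ E] [CompleteSpace E]

/-- The spectral family `E(t)` of a bounded self-adjoint operator `T` in a Hilbert space: the orthogonal projection
onto the kernel of the positive part `(T - t)₊` of `T - t`, that is, onto the spectral subspace of
`T` belonging to `(-∞, t]`. -/
def spectralFamily (T : E →L[ℂ] E) (t : ℝ) : E →L[ℂ] E :=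
  (LinearMap.ker (cfc (fun s : ℝ => max (s - t) 0) T).toLinearMap).starProjection

theorem ker_cfc_mono (T : E →L[ℂ] E) {t t' : ℝ} (h : t ≤ t') :
    LinearMap.ker (cfc (fun s : ℝ => max (s - t) 0) T).toLinearMap
      ≤ LinearMap.ker (cfc (fun s : ℝ => max (s - t') 0) T).toLinearMap := by
  rcases h.eq_or_lt with rfl | h
  · exact le_rfl
  intro x hx
  have hx' : cfc (fun s : ℝ => max (s - t) 0) T x = 0 := hx
  have hden : ∀ s : ℝ, max (s - t) (t' - t) ≠ 0 := fun s =>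
    (lt_of_lt_of_le (sub_pos.2 h) (le_max_right _ _)).ne'
  have hcont : Continuous fun s : ℝ => max (s - t') 0 / max (s - t) (t' - t) :=
    Continuous.div (by fun_prop) (by fun_prop) hden
  have hfun : (fun s : ℝ => max (s - t') 0)
      = fun s => (max (s - t') 0 / max (s - t) (t' - t)) * max (s - t) 0 := by
    funext s
    rcases le_total s t' with hs | hs
    · rw [max_eq_right (sub_nonpos.2 hs)]
      simp
    · rw [max_eq_left (sub_nonneg.2 hs), max_eq_left (by linarith : t' - t ≤ s - t),
        max_eq_left (by linarith : (0 : ℝ) ≤ s - t), div_mul_cancel₀]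
      linarith
  change cfc (fun s : ℝ => max (s - t') 0) T x = 0
  rw [hfun, cfc_mul _ _ T hcont.continuousOn (by fun_prop)]
  simp [hx']

theorem spectralFamily_mono (T : E →L[ℂ] E) (x : E) :
    Monotone fun t : ℝ => (inner ℂ x (spectralFamily T t x)).re := by
  intro t t' h
  have key : ∀ s : ℝ, (inner ℂ x (spectralFamily T s x)).re = ‖spectralFamily T s x‖ ^ 2 :=
    fun s => by
      rw [← inner_conj_symm, Complex.conj_re]
      exact Submodule.re_inner_starProjection_eq_normSq
        (LinearMap.ker (cfc (fun r : ℝ => max (r - s) 0) T).toLinearMap) x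
  have hcomp : spectralFamily T t x = spectralFamily T t (spectralFamily T t' x) := by
    have := Submodule.starProjection_comp_starProjection_of_le (ker_cfc_mono T h)
    exact (DFunLike.congr_fun this x).symm
  simp only [key]
  gcongr
  rw [hcomp]
  exact Submodule.norm_starProjection_apply_le _ _

/-- The measure `d(E(t)x, x)` on `ℝ`: the Lebesgue–Stieltjes measure of the nondecreasing function
`t ↦ (E(t)x, x)`. -/
def spectralMeasure (T : E →L[ℂ] E) (x : E) : Measure ℝ :=
  (spectralFamily_mono T x).stieltjesFunction.measure

/-- The spectrum of `T` is absolutely continuous on `S`: all the measures `d(E(t)x, x)` are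
absolutely continuous with respect to Lebesgue measure on `S`. -/
def IsSpectrallyACOn (T : E →L[ℂ] E) (S : Set ℝ) : Prop :=
  ∀ x : E, (spectralMeasure T x).restrict S ≪ volume

end SpectralFamily

/-! ### Orthogonal polynomials, Jost solutions and the Jost function

Sequences `{u_n}`, `n = -1, 0, 1, …`, are written as functions on `ℕ` with the index shifted by one:
`u k` stands for `u_{k-1}`. -/

/-- The coefficients `a_{n-1}`, `n = 0, 1, …`, with the convention `a_{-1} = 1/2`. -/
def prevCoeff (a : ℕ → ℝ) : ℕ → ℝ
  | 0 => 1 / 2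
  | n + 1 => a n

/-- The equation `a_{n-1} u_{n-1} + b_n u_n + a_n u_{n+1} = z u_n` for all `n ≥ 0`. -/
def SolvesJacobi (a b : ℕ → ℝ) (z : ℂ) (u : ℕ → ℂ) : Prop :=
  ∀ n : ℕ, prevCoeff a n * u n + b n * u (n + 1) + a n * u (n + 2) = z * u (n + 1)

/-- The Wronskian `{u, v} = a_n (u_n v_{n+1} - u_{n+1} v_n)`, evaluated at `n = -1`. For two
solutions of the Jacobi equation this expression does not depend on `n ≥ -1`. -/
def wronskian (a : ℕ → ℝ) (u v : ℕ → ℂ) : ℂ :=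
  prevCoeff a 0 * (u 0 * v 1 - u 1 * v 0)

/-- The polynomials `P_{-1} = 0, P_0 = 1, P_1, …` (index shifted by one) determined by
`a_{n-1} P_{n-1} + b_n P_n + a_n P_{n+1} = z P_n`. -/
def orthoPolyAux (a b : ℕ → ℝ) : ℕ → ℝ[X]
  | 0 => 0
  | 1 => 1
  | n + 2 => C (a n)⁻¹ *
      ((X - C (b n)) * orthoPolyAux a b (n + 1) - C (prevCoeff a n) * orthoPolyAux a b n)

/-- The orthonormal polynomial `P_n`, `n ≥ 0`. -/
def orthoPoly (a b : ℕ → ℝ) (n : ℕ) : ℝ[X] := orthoPolyAux a b (n + 1)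

/-- The polynomial solution `P(z) = {P_n(z)}`, `n ≥ -1`, of the Jacobi equation. -/
def polySolution (a b : ℕ → ℝ) (z : ℂ) (k : ℕ) : ℂ := aeval z (orthoPolyAux a b k)

theorem solvesJacobi_polySolution (a b : ℕ → ℝ) (ha : ∀ n, 0 < a n) (z : ℂ) :
    SolvesJacobi a b z (polySolution a b z) := by
  intro n
  have h : (a n : ℂ) ≠ 0 := by exact_mod_cast (ha n).ne'
  simp only [polySolution, orthoPolyAux, map_mul, map_sub, aeval_C, aeval_X,
    Complex.coe_algebraMap, Complex.ofReal_inv]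
  rw [mul_inv_cancel_left₀ h]
  ring

/-- The domain `Π = ℂ \ [-1, 1]`. -/
def cutPlane : Set ℂ := ((fun t : ℝ => (t : ℂ)) '' Icc (-1) 1)ᶜ

/-- The branch of `√(z² - 1)` that is analytic in `ℂ \ [-1, 1]` and positive for `z > 1`, as the
product of the principal branches of `√(z - 1)` and `√(z + 1)`. -/
def sqrtZ (z : ℂ) : ℂ := (z - 1) ^ (1 / 2 : ℂ) * (z + 1) ^ (1 / 2 : ℂ)

/-- `ζ(z) = z - √(z² - 1)`. -/
def zetaFn (z : ℂ) : ℂ := z - sqrtZ z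

/-- `ρ_n = ∑_{m ≥ n} (|a_m - 1/2| + |b_m|)`. -/
def coeffTail (a b : ℕ → ℝ) (n : ℕ) : ℝ := ∑' m : ℕ, (|a (n + m) - 1 / 2| + |b (n + m)|)

/-- `f` is a Jost solution at `z`: it solves the Jacobi equation and
`f_n = ζ(z)^n (1 + O(ρ_n))` as `n → ∞`. -/
def IsJostSolution (a b : ℕ → ℝ) (z : ℂ) (f : ℕ → ℂ) : Prop :=
  SolvesJacobi a b z f ∧
    (fun n : ℕ => f (n + 1) / zetaFn z ^ n - 1) =O[atTop] coeffTail a b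

/-- The Jost solution `f(z) = {f_n(z)}`, `n ≥ -1`, for `z ∈ ℂ \ [-1, 1]`. -/
def jostSolution (a b : ℕ → ℝ) (z : ℂ) : ℕ → ℂ := Classical.epsilon (IsJostSolution a b z)

/-- `ω(z) = {P(z), f(z)}`. -/
def omegaFn (a b : ℕ → ℝ) (z : ℂ) : ℂ := wronskian a (polySolution a b z) (jostSolution a b z)

/-- The Jost function `Ω(z) = -2 ζ(z) ω(z)`, `z ∈ ℂ \ [-1, 1]`. -/
def jostFunction (a b : ℕ → ℝ) (z : ℂ) : ℂ := -2 * zetaFn z * omegaFn a b z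

/-- The boundary value `Ω(t + i0)` from the upper half-plane. -/
def jostFunctionPlus (a b : ℕ → ℝ) (t : ℝ) : ℂ :=
  limUnder (𝓝[{z : ℂ | 0 < z.im}] (t : ℂ)) (jostFunction a b)

end

/-! The resolvent matrix of the Jacobi operator is explicit. For Im z > 0 its entries are P_min(n,m)
f_max(n,m) / ω with ω = {P, f} = -f_{-1}/2 (`exists_resolvent_column`). Stone's formula recovers the
spectral family from the boundary values of their imaginary parts, so the theorem reduces to three
facts: f and ω extend continuously to (-1, 1) from above, ω does not vanish there, and Im (f_k/ω) is
computable.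

Continuity. With z = (ζ + ζ⁻¹)/2, the cut plane corresponds to |ζ| < 1 and the upper edge of the cut
to |ζ| = 1. For g_n = ζ⁻ⁿ f_n the equation is a backward recursion on pairs. In suitable coordinates
its free part is diag(1, ζ²), a contraction fixing (1, 0), and the rest is summable, uniformly for
|ζ| ≤ 1 away from 0, 1, -1. The solution with limit (1, 0) is therefore a uniformly convergent
series of continuous functions (`isSummablePerturbation_jostStep`, `continuousOn_backSol`), and its
tail bound gives the asymptotics of f.

Non-vanishing. If ω(z) = 0 at a non-real z, then f is an ℓ² eigenvector of a self-adjoint operator.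
On the cut the asymptotics give {f, f̄} = i√(1 - t²) ≠ 0 (`wronskian_jostSeq_conj`), which is
impossible if f_{-1} = 0. The same Wronskian yields Im (f_k/ω) = P_k √(1 - t²) / (2|ω|²), and |Ω| =
2|ω| on the cut turns this, divided by π, into the stated density (`im_greenSeq_ofReal`).

Stone's formula. Integrating the Poisson kernel in l produces arctan steps, which approximate
indicators of half-lines; comparison in the sense of quadratic forms pins the increments of the
spectral family (`spectralFamily_increment`). Polarisation supplies the off-diagonal densities, and
absolute continuity passes from the basis to every vector because vectors with null spectral measure
form a closed subspace (`isSpectrallyACOn_of_dense`). -/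

noncomputable section

/-! ### Spectral family versus continuous functional calculus -/

section SpectralTheory

variable {E : Type*} [NormedAddCommGroup E] [InnerProductSpace ℂ E] [CompleteSpace E]

theorem re_inner_spectralFamily (T : E →L[ℂ] E) (t : ℝ) (x : E) :
    (inner ℂ x (spectralFamily T t x)).re = ‖spectralFamily T t x‖ ^ 2 := by
  rw [← inner_conj_symm, Complex.conj_re]
  exact Submodule.re_inner_starProjection_eq_normSq
    (LinearMap.ker (cfc (fun r : ℝ => max (r - t) 0) T).toLinearMap) x

theorem isSelfAdjoint_spectralFamily (T : E →L[ℂ] E) (t : ℝ) :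
    IsSelfAdjoint (spectralFamily T t) :=
  isSelfAdjoint_starProjection _

theorem norm_sub_spectralFamily_sq (T : E →L[ℂ] E) (t : ℝ) (x : E) :
    ‖x - spectralFamily T t x‖ ^ 2 = ‖x‖ ^ 2 - ‖spectralFamily T t x‖ ^ 2 := by
  have h := @norm_sub_sq ℂ E _ _ _ x (spectralFamily T t x)
  have h2 := re_inner_spectralFamily T t x
  rw [h]
  simp only [RCLike.re_to_complex, h2]
  ring

theorem spectralFamily_apply_of_ker (T : E →L[ℂ] E) (t : ℝ) {x : E}
    (hx : cfc (fun r : ℝ => max (r - t) 0) T x = 0) : spectralFamily T t x = x :=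
  Submodule.starProjection_eq_self_iff.2 hx

theorem cfc_spectralFamily_apply (T : E →L[ℂ] E) (t : ℝ) (x : E) :
    cfc (fun r : ℝ => max (r - t) 0) T (spectralFamily T t x) = 0 :=
  Submodule.starProjection_apply_mem
    (LinearMap.ker (cfc (fun r : ℝ => max (r - t) 0) T).toLinearMap) x

theorem inner_cfc_apply (T : E →L[ℂ] E) (f : ℝ → ℝ) (x y : E) :
    inner ℂ (cfc f T x) y = inner ℂ x (cfc f T y) := by
  have h : IsSelfAdjoint (cfc f T) := cfc_predicate f T
  exact (ContinuousLinearMap.isSelfAdjoint_iff_isSymmetric.1 h) x y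

/-- Writing the form as a squared norm turns every operator inequality below into a norm estimate
for `cfc (fun s => √(f s)) T`. -/
theorem re_inner_cfc_sqrt (T : E →L[ℂ] E) {f : ℝ → ℝ} (hf : Continuous f)
    (h0 : ∀ s, 0 ≤ f s) (x : E) :
    (inner ℂ x (cfc f T x)).re = ‖cfc (fun s => √(f s)) T x‖ ^ 2 := by
  have h : f = fun s => √(f s) * √(f s) := by
    funext s
    rw [Real.mul_self_sqrt (h0 s)]
  conv_lhs => rw [h]
  rw [cfc_mul _ _ T (by fun_prop) (by fun_prop), mul_apply_eq_comp,
    ← inner_cfc_apply, inner_self_eq_norm_sq_to_K]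
  norm_cast

theorem norm_cfc_apply_le (T : E →L[ℂ] E) {f : ℝ → ℝ} (h1 : ∀ s, |f s| ≤ 1) (x : E) :
    ‖cfc f T x‖ ≤ ‖x‖ := by
  have h : ‖cfc f T‖ ≤ 1 := norm_cfc_le zero_le_one fun s _ => h1 s
  calc ‖cfc f T x‖ ≤ ‖cfc f T‖ * ‖x‖ := (cfc f T).le_opNorm x
    _ ≤ 1 * ‖x‖ := by gcongr
    _ = ‖x‖ := one_mul _

theorem re_inner_cfc_mono (T : E →L[ℂ] E) {f g : ℝ → ℝ} (hf : Continuous f)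
    (hg : Continuous g) (h : ∀ s, f s ≤ g s) (x : E) :
    (inner ℂ x (cfc f T x)).re ≤ (inner ℂ x (cfc g T x)).re := by
  have h1 := re_inner_cfc_sqrt T (f := fun s => g s - f s) (by fun_prop)
    (fun s => sub_nonneg.2 (h s)) x
  rw [cfc_sub g f T (by fun_prop) (by fun_prop)] at h1
  simp only [sub_apply, inner_sub_right, Complex.sub_re] at h1
  nlinarith [sq_nonneg ‖cfc (fun s => √(g s - f s)) T x‖]

theorem re_inner_cfc_add_const (T : E →L[ℂ] E) (hT : IsSelfAdjoint T) {f : ℝ → ℝ}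
    (hf : Continuous f) (δ : ℝ) (x : E) :
    (inner ℂ x (cfc (fun s => f s + δ) T x)).re
      = (inner ℂ x (cfc f T x)).re + δ * ‖x‖ ^ 2 := by
  rw [cfc_add_const δ f T (by fun_prop) hT]
  simp only [add_apply, inner_add_right, Complex.add_re]
  congr 1
  rw [Algebra.algebraMap_eq_smul_one]
  have : (δ • (1 : E →L[ℂ] E)) x = (δ : ℂ) • x := by simp
  rw [this, inner_smul_right, inner_self_eq_norm_sq_to_K, Complex.re_ofReal_mul]
  norm_cast

/-- Since f vanishes on [t, ∞), the product (T - t)₊ √f(T) is zero, so √f(T) has range in the kernel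
defining E(t). By self-adjointness √f(T) = √f(T) E(t), and √f(T) is a contraction. -/
theorem re_inner_cfc_le_spectralFamily (T : E →L[ℂ] E) {f : ℝ → ℝ} (hf : Continuous f)
    (h0 : ∀ s, 0 ≤ f s) (h1 : ∀ s, f s ≤ 1) {t : ℝ} (ht : ∀ s, t ≤ s → f s = 0) (x : E) :
    (inner ℂ x (cfc f T x)).re ≤ (inner ℂ x (spectralFamily T t x)).re := by
  have hz : (fun s => max (s - t) 0 * √(f s)) = fun _ => (0 : ℝ) := by
    funext s
    rcases le_total s t with h | h
    · simp [h]
    · simp [ht s h]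
  have hE : ∀ y, spectralFamily T t (cfc (fun s => √(f s)) T y) = cfc (fun s => √(f s)) T y := by
    intro y
    apply spectralFamily_apply_of_ker
    rw [← mul_apply_eq_comp, ← cfc_mul _ _ T (by fun_prop) (by fun_prop), hz]
    simp
  have hE' : cfc (fun s => √(f s)) T (spectralFamily T t x) = cfc (fun s => √(f s)) T x := by
    refine ext_inner_right ℂ fun y => ?_
    rw [inner_cfc_apply, inner_cfc_apply]
    have := ContinuousLinearMap.isSelfAdjoint_iff_isSymmetric.1
      (isSelfAdjoint_spectralFamily T t) x (cfc (fun s => √(f s)) T y)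
    exact this.trans (by simp [hE])
  rw [re_inner_cfc_sqrt T hf h0, re_inner_spectralFamily, ← hE']
  gcongr
  refine norm_cfc_apply_le T (fun s => ?_) _
  rw [abs_of_nonneg (Real.sqrt_nonneg _)]
  exact Real.sqrt_le_one.2 (h1 s)

/-- The function g = h · (s - t)₊ is a multiple of (s - t)₊, so g(T) annihilates E(t)x. Hence
(g(T)x, x) only sees x - E(t)x and is at most ‖x‖² - ‖E(t)x‖². -/
theorem spectralFamily_le_re_inner_cfc (T : E →L[ℂ] E) (hT : IsSelfAdjoint T) {h : ℝ → ℝ}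
    (hh : Continuous h) (h0 : ∀ s, 0 ≤ h s) {t : ℝ} (h1 : ∀ s, h s * max (s - t) 0 ≤ 1) (x : E) :
    (inner ℂ x (spectralFamily T t x)).re
      ≤ (inner ℂ x (cfc (fun s => 1 - h s * max (s - t) 0) T x)).re := by
  set g : ℝ → ℝ := fun s => h s * max (s - t) 0 with hg
  have hgc : Continuous g := by fun_prop
  have hg0 : ∀ s, 0 ≤ g s := fun s => mul_nonneg (h0 s) (le_max_right _ _)
  have hker : cfc (fun s => √(g s)) T (spectralFamily T t x) = 0 := by
    have h2 := re_inner_cfc_sqrt T hgc hg0 (spectralFamily T t x)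
    have h3 : cfc g T (spectralFamily T t x) = 0 := by
      rw [hg, cfc_mul _ _ T (by fun_prop) (by fun_prop), mul_apply_eq_comp,
        cfc_spectralFamily_apply, map_zero]
    rw [h3] at h2
    simpa using h2.symm
  have h3 : cfc (fun s => √(g s)) T x = cfc (fun s => √(g s)) T (x - spectralFamily T t x) := by
    rw [map_sub, hker, sub_zero]
  have h4 : (inner ℂ x (cfc g T x)).re ≤ ‖x‖ ^ 2 - ‖spectralFamily T t x‖ ^ 2 := by
    rw [re_inner_cfc_sqrt T hgc hg0, h3, ← norm_sub_spectralFamily_sq]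
    gcongr
    refine norm_cfc_apply_le T (fun s => ?_) _
    rw [abs_of_nonneg (Real.sqrt_nonneg _)]
    exact Real.sqrt_le_one.2 (h1 s)
  have h5 : (inner ℂ x (cfc (fun s => 1 - g s) T x)).re
      = ‖x‖ ^ 2 - (inner ℂ x (cfc g T x)).re := by
    rw [cfc_sub (fun _ => 1) g T (by fun_prop) (by fun_prop), cfc_const_one ℝ T]
    simp only [sub_apply, inner_sub_right, Complex.sub_re,
      one_apply_eq_self, inner_self_eq_norm_sq_to_K]
    norm_cast
  rw [h5, re_inner_spectralFamily]
  linarith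

/-- The continuous function which is `1` on `(-∞, c]`, `0` on `[d, ∞)` and affine between. -/
def ramp (c d s : ℝ) : ℝ := 1 - (max (d - c) (s - c))⁻¹ * max (s - c) 0

theorem ramp_denom_pos {c d : ℝ} (h : c < d) (s : ℝ) : 0 < max (d - c) (s - c) :=
  lt_max_of_lt_left (sub_pos.2 h)

theorem continuous_ramp_aux {c d : ℝ} (h : c < d) :
    Continuous fun s : ℝ => (max (d - c) (s - c))⁻¹ :=
  Continuous.inv₀ (by fun_prop) fun s => (ramp_denom_pos h s).ne'

theorem continuous_ramp {c d : ℝ} (h : c < d) : Continuous (ramp c d) := by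
  have := continuous_ramp_aux h
  unfold ramp
  fun_prop

theorem ramp_aux_le_one {c d : ℝ} (h : c < d) (s : ℝ) :
    (max (d - c) (s - c))⁻¹ * max (s - c) 0 ≤ 1 := by
  rw [inv_mul_le_iff₀ (ramp_denom_pos h s), mul_one]
  exact max_le (le_max_right _ _) (ramp_denom_pos h s).le

theorem ramp_nonneg {c d : ℝ} (h : c < d) (s : ℝ) : 0 ≤ ramp c d s :=
  sub_nonneg.2 (ramp_aux_le_one h s)

theorem ramp_le_one {c d : ℝ} (h : c < d) (s : ℝ) : ramp c d s ≤ 1 :=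
  sub_le_self _ (mul_nonneg (inv_nonneg.2 (ramp_denom_pos h s).le) (le_max_right _ _))

theorem ramp_of_le {c d s : ℝ} (hs : s ≤ c) : ramp c d s = 1 := by
  simp [ramp, hs]

theorem ramp_of_ge {c d s : ℝ} (h : c < d) (hs : d ≤ s) : ramp c d s = 0 := by
  rw [ramp, max_eq_right (by linarith), max_eq_left (by linarith), inv_mul_cancel₀, sub_self]
  linarith

theorem re_inner_ramp_le (T : E →L[ℂ] E) {c d : ℝ} (h : c < d) (x : E) :
    (inner ℂ x (cfc (ramp c d) T x)).re ≤ (inner ℂ x (spectralFamily T d x)).re :=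
  re_inner_cfc_le_spectralFamily T (continuous_ramp h) (ramp_nonneg h) (ramp_le_one h)
    (fun _ hs => ramp_of_ge h hs) x

/-- The factored formula for `ramp` serves here: `1 - ramp c d` is visibly (s - c)₊ times a
continuous nonnegative function. -/
theorem le_re_inner_ramp (T : E →L[ℂ] E) (hT : IsSelfAdjoint T) {c d : ℝ} (h : c < d) (x : E) :
    (inner ℂ x (spectralFamily T c x)).re ≤ (inner ℂ x (cfc (ramp c d) T x)).re :=
  spectralFamily_le_re_inner_cfc T hT (continuous_ramp_aux h)
    (fun s => (inv_nonneg.2 (ramp_denom_pos h s).le)) (ramp_aux_le_one h) x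

/-- A smooth approximation of the indicator function of `(-∞, c]`. -/
def arctanStep (c ε s : ℝ) : ℝ := 1 / 2 + Real.arctan ((c - s) / ε) / Real.pi

theorem continuous_arctanStep (c ε : ℝ) : Continuous (arctanStep c ε) := by
  unfold arctanStep
  fun_prop

theorem arctanStep_nonneg (c ε s : ℝ) : 0 ≤ arctanStep c ε s := by
  have h := Real.neg_pi_div_two_lt_arctan ((c - s) / ε)
  have hp := Real.pi_pos
  have : -(1 / 2) ≤ Real.arctan ((c - s) / ε) / Real.pi := by
    rw [le_div_iff₀ hp]
    linarith
  unfold arctanStep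
  linarith

theorem arctanStep_le_one (c ε s : ℝ) : arctanStep c ε s ≤ 1 := by
  have h := Real.arctan_lt_pi_div_two ((c - s) / ε)
  have hp := Real.pi_pos
  have : Real.arctan ((c - s) / ε) / Real.pi ≤ 1 / 2 := by
    rw [div_le_iff₀ hp]
    linarith
  unfold arctanStep
  linarith

theorem arctanStep_antitone (c : ℝ) {ε : ℝ} (hε : 0 < ε) : Antitone (arctanStep c ε) := by
  intro s s' h
  unfold arctanStep
  have := Real.pi_pos
  gcongr

theorem tendsto_arctanStep_of_lt {c s : ℝ} (h : s < c) :
    Tendsto (fun ε => arctanStep c ε s) (𝓝[>] 0) (𝓝 1) := by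
  have h1 : Tendsto (fun ε : ℝ => (c - s) / ε) (𝓝[>] 0) atTop := by
    simpa [div_eq_mul_inv] using tendsto_inv_nhdsGT_zero.const_mul_atTop (sub_pos.2 h)
  have h2 := (Real.tendsto_arctan_atTop.mono_right nhdsWithin_le_nhds).comp h1
  have h3 := (h2.div_const Real.pi).const_add (1 / 2)
  have hp : (1 : ℝ) / 2 + Real.pi / 2 / Real.pi = 1 := by
    field_simp [Real.pi_ne_zero]
    norm_num
  rw [hp] at h3
  exact h3

theorem tendsto_arctanStep_of_gt {c s : ℝ} (h : c < s) :
    Tendsto (fun ε => arctanStep c ε s) (𝓝[>] 0) (𝓝 0) := by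
  have h1 : Tendsto (fun ε : ℝ => (c - s) / ε) (𝓝[>] 0) atBot := by
    simpa [div_eq_mul_inv] using tendsto_inv_nhdsGT_zero.const_mul_atTop_of_neg (sub_neg.2 h)
  have h2 := (Real.tendsto_arctan_atBot.mono_right nhdsWithin_le_nhds).comp h1
  have h3 := (h2.div_const Real.pi).const_add (1 / 2)
  have hp : (1 : ℝ) / 2 + -(Real.pi / 2) / Real.pi = 0 := by
    field_simp [Real.pi_ne_zero]
    norm_num
  rw [hp] at h3
  exact h3

theorem eventually_arctanStep_le (T : E →L[ℂ] E) (hT : IsSelfAdjoint T) (x : E) {c d δ : ℝ}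
    (h : c < d) (hδ : 0 < δ) :
    ∀ᶠ ε in 𝓝[>] (0 : ℝ), (inner ℂ x (cfc (arctanStep c ε) T x)).re
      ≤ (inner ℂ x (spectralFamily T d x)).re + δ * ‖x‖ ^ 2 := by
  obtain ⟨e, hce, hed⟩ := exists_between h
  filter_upwards [(tendsto_arctanStep_of_gt hce).eventually_lt_const hδ, self_mem_nhdsWithin]
    with ε hε hε0
  calc (inner ℂ x (cfc (arctanStep c ε) T x)).re
      ≤ (inner ℂ x (cfc (fun s => ramp e d s + δ) T x)).re := by
        have hr := continuous_ramp hed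
        refine re_inner_cfc_mono T (continuous_arctanStep c ε) (by fun_prop) (fun s => ?_) x
        -- Left of e the ramp equals 1 and dominates trivially; right of e monotonicity bounds the
        -- arctan step by its value at e, which is below δ for small ε.
        rcases le_total s e with hs | hs
        · rw [ramp_of_le hs]
          linarith [arctanStep_le_one c ε s]
        · have := arctanStep_antitone c hε0 hs
          linarith [ramp_nonneg hed s]
    _ = (inner ℂ x (cfc (ramp e d) T x)).re + δ * ‖x‖ ^ 2 :=
        re_inner_cfc_add_const T hT (continuous_ramp hed) δ x
    _ ≤ _ := by
        have := re_inner_ramp_le T hed x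
        linarith

theorem eventually_le_arctanStep (T : E →L[ℂ] E) (hT : IsSelfAdjoint T) (x : E) {c d δ : ℝ}
    (h : d < c) (hδ : 0 < δ) :
    ∀ᶠ ε in 𝓝[>] (0 : ℝ), (inner ℂ x (spectralFamily T d x)).re - δ * ‖x‖ ^ 2
      ≤ (inner ℂ x (cfc (arctanStep c ε) T x)).re := by
  obtain ⟨e, hde, hec⟩ := exists_between h
  filter_upwards [(tendsto_arctanStep_of_lt hec).eventually_const_lt
    (sub_lt_self 1 hδ), self_mem_nhdsWithin] with ε hε hε0
  have key : (inner ℂ x (cfc (ramp d e) T x)).re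
      ≤ (inner ℂ x (cfc (fun s => arctanStep c ε s + δ) T x)).re := by
    have hs := continuous_arctanStep c ε
    refine re_inner_cfc_mono T (continuous_ramp hde) (by fun_prop) (fun s => ?_) x
    rcases le_total s e with hs | hs
    · have := arctanStep_antitone c hε0 hs
      linarith [ramp_le_one hde s]
    · rw [ramp_of_ge hde hs]
      linarith [arctanStep_nonneg c ε s]
  rw [re_inner_cfc_add_const T hT (continuous_arctanStep c ε)] at key
  linarith [le_re_inner_ramp T hT hde x]

/-- The Poisson kernel (without the factor `1 / π`). -/
def poissonKer (ε l s : ℝ) : ℝ := ε / ((s - l) ^ 2 + ε ^ 2)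

theorem poissonKer_denom_pos {ε : ℝ} (hε : 0 < ε) (l s : ℝ) : 0 < (s - l) ^ 2 + ε ^ 2 := by
  positivity

theorem continuous_poissonKer {ε : ℝ} (hε : 0 < ε) :
    Continuous (Function.uncurry (poissonKer ε)) := by
  unfold poissonKer Function.uncurry
  exact Continuous.div (by fun_prop) (by fun_prop)
    fun p => (poissonKer_denom_pos hε p.1 p.2).ne'

theorem continuous_poissonKer_right {ε : ℝ} (hε : 0 < ε) (l : ℝ) :
    Continuous (poissonKer ε l) :=
  (continuous_poissonKer hε).comp (Continuous.prodMk_right l)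

theorem hasDerivAt_arctanStep {ε : ℝ} (hε : 0 < ε) (l s : ℝ) :
    HasDerivAt (fun l => arctanStep l ε s) (poissonKer ε l s / Real.pi) l := by
  have h1 : HasDerivAt (fun l : ℝ => (l - s) / ε) (1 / ε) l :=
    ((hasDerivAt_id l).sub_const s).div_const ε
  have h2 := ((h1.arctan).div_const Real.pi).const_add (1 / 2)
  refine h2.congr_deriv ?_
  unfold poissonKer
  have h3 := (poissonKer_denom_pos hε l s).ne'
  have h4 : 1 + ((l - s) / ε) ^ 2 ≠ 0 := by positivity
  congr 1
  field_simp
  ring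

theorem integral_poissonKer {ε : ℝ} (hε : 0 < ε) (α β s : ℝ) :
    ∫ l in α..β, poissonKer ε l s
      = Real.pi * (arctanStep β ε s - arctanStep α ε s) := by
  have hc : Continuous fun l => poissonKer ε l s :=
    (continuous_poissonKer hε).comp (Continuous.prodMk_left s)
  have := intervalIntegral.integral_eq_sub_of_hasDerivAt (a := α) (b := β)
    (fun l _ => hasDerivAt_arctanStep hε l s)
    ((hc.div_const _).intervalIntegrable _ _)
  rw [← this, intervalIntegral.integral_div]
  field_simp [Real.pi_ne_zero]

theorem poissonKer_le {ε : ℝ} (hε : 0 < ε) (l s : ℝ) : ‖poissonKer ε l s‖ ≤ 1 / ε := by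
  have h := poissonKer_denom_pos hε l s
  rw [poissonKer, Real.norm_of_nonneg (by positivity), div_le_div_iff₀ h hε]
  nlinarith [sq_nonneg (s - l)]

/-- The Poisson kernel of an operator, `ε ((T - l)² + ε²)⁻¹`. -/
def poissonOp (T : E →L[ℂ] E) (ε l : ℝ) : E →L[ℂ] E := cfc (poissonKer ε l) T

/-- The integral over l commutes with the functional calculus, and the scalar Poisson kernel has an
arctan primitive in l. -/
theorem integral_inner_poissonOp (T : E →L[ℂ] E) (hT : IsSelfAdjoint T) (x : E) {ε : ℝ}
    (hε : 0 < ε) {α β : ℝ} (h : α ≤ β) :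
    ∫ l in α..β, (inner ℂ x (poissonOp T ε l x)).re
      = Real.pi * ((inner ℂ x (cfc (arctanStep β ε) T x)).re
        - (inner ℂ x (cfc (arctanStep α ε) T x)).re) := by
  have hb : HasFiniteIntegral (fun _ : ℝ => 1 / ε) (volume.restrict (Ioc α β)) :=
    (integrable_const _).2
  have h1 : cfc (fun s => ∫ l in Ioc α β, poissonKer ε l s) T
      = ∫ l in Ioc α β, cfc (poissonKer ε l) T :=
    cfc_setIntegral measurableSet_Ioc (poissonKer ε) (fun _ => 1 / ε) T
      (continuous_poissonKer hε).continuousOn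
      (ae_of_all _ fun l s _ => poissonKer_le hε l s) hb hT
  have h2 : IntegrableOn (fun l => cfc (poissonKer ε l) T) (Ioc α β) :=
    integrableOn_cfc measurableSet_Ioc (poissonKer ε) (fun _ => 1 / ε) T
      (continuous_poissonKer hε).continuousOn
      (ae_of_all _ fun l s _ => poissonKer_le hε l s) hb hT
  let Λ : (E →L[ℂ] E) →L[ℝ] ℝ :=
    Complex.reCLM.comp (((innerSL ℂ x).comp
      (ContinuousLinearMap.apply ℂ E x)).restrictScalars ℝ)
  have hΛ : ∀ A : E →L[ℂ] E, Λ A = (inner ℂ x (A x)).re := fun A => rfl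
  have h3 := Λ.integral_comp_comm h2
  rw [intervalIntegral.integral_of_le h]
  unfold poissonOp
  simp only [hΛ] at h3
  rw [h3, ← h1]
  have h4 : (fun s => ∫ l in Ioc α β, poissonKer ε l s)
      = fun s => Real.pi * (arctanStep β ε s - arctanStep α ε s) := by
    funext s
    rw [← integral_poissonKer hε, intervalIntegral.integral_of_le h]
  have hcβ := continuous_arctanStep β ε
  have hcα := continuous_arctanStep α ε
  rw [h4, cfc_const_mul _ _ T (by fun_prop),
    cfc_sub (arctanStep β ε) (arctanStep α ε) T (by fun_prop) (by fun_prop)]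
  simp [inner_smul_right_eq_smul, inner_sub_right]

end SpectralTheory

/-! ### Stone's formula and the density of the spectral family -/

section SpectralDensity

variable {E : Type*} [NormedAddCommGroup E] [InnerProductSpace ℂ E] [CompleteSpace E]

/-- The arctan steps converge to 1 or 0 only away from their centres, where the limit is 1/2. This
is why the endpoints must be moved strictly outward or inward. -/
theorem integral_sub_le_of_tendsto_poissonOp {T : E →L[ℂ] E} (hT : IsSelfAdjoint T) {x : E}
    {α β q : ℝ} (h : α ≤ β)
    (hq : Tendsto (fun ε => ∫ l in α..β, (inner ℂ x (poissonOp T ε l x)).re)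
      (𝓝[>] 0) (𝓝 (Real.pi * q))) :
    (∀ α' β', α' < α → β < β' →
      q ≤ (inner ℂ x (spectralFamily T β' x)).re - (inner ℂ x (spectralFamily T α' x)).re) ∧
    (∀ α' β', α < α' → β' < β →
      (inner ℂ x (spectralFamily T β' x)).re - (inner ℂ x (spectralFamily T α' x)).re ≤ q) := by
  have hq' : Tendsto (fun ε => (inner ℂ x (cfc (arctanStep β ε) T x)).re
      - (inner ℂ x (cfc (arctanStep α ε) T x)).re) (𝓝[>] 0) (𝓝 q) := by
    have h1 := hq.const_mul (Real.pi⁻¹)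
    rw [inv_mul_cancel_left₀ Real.pi_ne_zero] at h1
    refine h1.congr' ?_
    filter_upwards [self_mem_nhdsWithin] with ε hε
    rw [integral_inner_poissonOp T hT x hε h, inv_mul_cancel_left₀ Real.pi_ne_zero]
  have small : ∀ η : ℝ, 0 < η → ∃ δ : ℝ, 0 < δ ∧ 2 * (δ * ‖x‖ ^ 2) ≤ η := by
    intro η hη
    refine ⟨η / (2 * (‖x‖ ^ 2 + 1)), by positivity, ?_⟩
    rw [div_mul_eq_mul_div, mul_div_assoc', div_le_iff₀ (by positivity)]
    nlinarith [sq_nonneg ‖x‖]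
  constructor
  · intro α' β' hα hβ
    refine le_of_forall_pos_le_add fun η hη => ?_
    obtain ⟨δ, hδ, hδη⟩ := small η hη
    refine le_of_tendsto hq' ?_
    filter_upwards [eventually_arctanStep_le T hT x hβ hδ,
      eventually_le_arctanStep T hT x hα hδ] with ε h1 h2
    linarith
  · intro α' β' hα hβ
    refine le_of_forall_pos_le_add fun η hη => ?_
    obtain ⟨δ, hδ, hδη⟩ := small η hη
    rw [← sub_le_iff_le_add]
    refine ge_of_tendsto hq' ?_
    filter_upwards [eventually_arctanStep_le T hT x hα hδ,
      eventually_le_arctanStep T hT x hβ hδ] with ε h1 h2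
    linarith

theorem hasDerivAt_integral_of_continuousOn_Ioo {g : ℝ → ℝ} {A B : ℝ}
    (hg : ContinuousOn g (Ioo A B)) {c t : ℝ} (hc : c ∈ Ioo A B) (ht : t ∈ Ioo A B) :
    HasDerivAt (fun u => ∫ l in c..u, g l) (g t) t := by
  have hsub : uIcc c t ⊆ Ioo A B := ordConnected_Ioo.uIcc_subset hc ht
  exact intervalIntegral.integral_hasDerivAt_right ((hg.mono hsub).intervalIntegrable)
    (hg.stronglyMeasurableAtFilter isOpen_Ioo t ht) (hg.continuousAt (Ioo_mem_nhds ht.1 ht.2))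

/-- Stone's formula: the increments of the spectral family are determined by the boundary values
of the imaginary part of the resolvent. -/
theorem spectralFamily_increment {T : E →L[ℂ] E} (hT : IsSelfAdjoint T) {x : E} {g : ℝ → ℝ}
    {A B : ℝ} (hg : ContinuousOn g (Ioo A B))
    (hlim : ∀ α ∈ Ioo A B, ∀ β ∈ Ioo A B, α ≤ β →
      Tendsto (fun ε => ∫ l in α..β, (inner ℂ x (poissonOp T ε l x)).re)
        (𝓝[>] 0) (𝓝 (Real.pi * ∫ l in α..β, g l)))
    {α β : ℝ} (hα : α ∈ Ioo A B) (hβ : β ∈ Ioo A B) (h : α ≤ β) :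
    (inner ℂ x (spectralFamily T β x)).re - (inner ℂ x (spectralFamily T α x)).re
      = ∫ l in α..β, g l := by
  set F : ℝ → ℝ := fun t => (inner ℂ x (spectralFamily T t x)).re with hF
  have hFm : Monotone F := spectralFamily_mono T x
  set G : ℝ → ℝ := fun t => ∫ l in α..t, g l with hG
  have hint : ∀ u ∈ Ioo A B, ∀ v ∈ Ioo A B, IntervalIntegrable g volume u v := fun u hu v hv =>
    (hg.mono (ordConnected_Ioo.uIcc_subset hu hv)).intervalIntegrable
  have hGsub : ∀ u ∈ Ioo A B, ∀ v ∈ Ioo A B, ∫ l in u..v, g l = G v - G u := fun u hu v hv =>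
    (intervalIntegral.integral_interval_sub_left (hint _ hα _ hv) (hint _ hα _ hu)).symm
  have hGc : ∀ t ∈ Ioo A B, ContinuousAt G t := fun t ht =>
    (hasDerivAt_integral_of_continuousOn_Ioo hg hα ht).continuousAt
  -- F is not yet known to be continuous, so the limits in the shifted endpoints are taken in G
  -- alone, one endpoint at a time.
  have up : ∀ u ∈ Ioo A B, ∀ v ∈ Ioo A B, u ≤ v → F v - F u ≤ G v - G u := by
    intro u hu v hv huv
    have h1 : ∀ u' v', A < u' → u' < u → v < v' → v' < B → F v - F u ≤ G v' - G u' := by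
      intro u' v' h1 h2 h3 h4
      have hu' : u' ∈ Ioo A B := ⟨h1, h2.trans hu.2⟩
      have hv' : v' ∈ Ioo A B := ⟨hv.1.trans h3, h4⟩
      have := (integral_sub_le_of_tendsto_poissonOp hT (by linarith : u' ≤ v')
        (hlim u' hu' v' hv' (by linarith))).2 u v h2 h3
      rwa [hGsub u' hu' v' hv'] at this
    have h2 : ∀ u', A < u' → u' < u → F v - F u ≤ G v - G u' := by
      intro u' h2 h3
      have ht : Tendsto (fun v' => G v' - G u') (𝓝[>] v) (𝓝 (G v - G u')) :=
        ((hGc v hv).tendsto.mono_left nhdsWithin_le_nhds).sub_const _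
      refine ge_of_tendsto ht ?_
      filter_upwards [Ioo_mem_nhdsGT hv.2] with v' hv'
      exact h1 u' v' h2 h3 hv'.1 hv'.2
    have ht : Tendsto (fun u' => G v - G u') (𝓝[<] u) (𝓝 (G v - G u)) :=
      ((hGc u hu).tendsto.mono_left nhdsWithin_le_nhds).const_sub _
    refine ge_of_tendsto ht ?_
    filter_upwards [Ioo_mem_nhdsLT hu.1] with u' hu'
    exact h2 u' hu'.1 hu'.2
  have lo : ∀ u ∈ Ioo A B, ∀ v ∈ Ioo A B, u < v → G v - G u ≤ F v - F u := by
    intro u hu v hv huv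
    have h1 : ∀ u' v', u < u' → u' < v' → v' < v → G v' - G u' ≤ F v - F u := by
      intro u' v' h1 h2 h3
      have hu' : u' ∈ Ioo A B := ⟨hu.1.trans h1, by linarith [hv.2]⟩
      have hv' : v' ∈ Ioo A B := ⟨by linarith [hu.1], h3.trans hv.2⟩
      have := (integral_sub_le_of_tendsto_poissonOp hT h2.le
        (hlim u' hu' v' hv' h2.le)).1 u v h1 h3
      rwa [hGsub u' hu' v' hv'] at this
    have h2 : ∀ u', u < u' → u' < v → G v - G u' ≤ F v - F u := by
      intro u' h2 h3
      have ht : Tendsto (fun v' => G v' - G u') (𝓝[<] v) (𝓝 (G v - G u')) :=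
        ((hGc v hv).tendsto.mono_left nhdsWithin_le_nhds).sub_const _
      refine le_of_tendsto ht ?_
      filter_upwards [Ioo_mem_nhdsLT h3] with v' hv'
      exact h1 u' v' h2 hv'.1 hv'.2
    have ht : Tendsto (fun u' => G v - G u') (𝓝[>] u) (𝓝 (G v - G u)) :=
      ((hGc u hu).tendsto.mono_left nhdsWithin_le_nhds).const_sub _
    refine le_of_tendsto ht ?_
    filter_upwards [Ioo_mem_nhdsGT huv] with u' hu'
    exact h2 u' hu'.1 hu'.2
  rw [hGsub α hα β hβ]
  rcases h.eq_or_lt with rfl | h'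
  · simp
  · exact le_antisymm (up α hα β hβ h) (lo α hα β hβ h')

theorem hasDerivAt_of_increment {F g : ℝ → ℝ} {A B : ℝ} (hg : ContinuousOn g (Ioo A B))
    (hinc : ∀ α ∈ Ioo A B, ∀ β ∈ Ioo A B, α ≤ β → F β - F α = ∫ l in α..β, g l)
    {t : ℝ} (ht : t ∈ Ioo A B) : HasDerivAt F (g t) t := by
  obtain ⟨c, hc, hct⟩ := exists_between ht.1
  have hcI : c ∈ Ioo A B := ⟨hc, hct.trans ht.2⟩
  have h1 := (hasDerivAt_integral_of_continuousOn_Ioo hg hcI ht).const_add (F c)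
  refine h1.congr_of_eventuallyEq ?_
  filter_upwards [Ioo_mem_nhds hct ht.2] with s hs
  rw [← hinc c hcI s ⟨hc.trans hs.1, hs.2⟩ hs.1.le]
  ring

theorem stieltjesFunction_apply_of_continuousAt {F : ℝ → ℝ} (hF : Monotone F) {t : ℝ}
    (h : ContinuousAt F t) : hF.stieltjesFunction t = F t := by
  rw [hF.stieltjesFunction_eq]
  exact hF.continuousWithinAt_Ioi_iff_rightLim_eq.1 h.continuousWithinAt

/-- The density need not be integrable up to A and B, so the measures are compared on half-open
intervals compactly inside and the result is glued along a countable exhaustion. -/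
theorem restrict_measure_stieltjes_eq_withDensity {F g : ℝ → ℝ} (hF : Monotone F) {A B : ℝ}
    (hAB : A < B) (hg : ContinuousOn g (Ioo A B)) (hg0 : ∀ t ∈ Ioo A B, 0 ≤ g t)
    (hinc : ∀ α ∈ Ioo A B, ∀ β ∈ Ioo A B, α ≤ β → F β - F α = ∫ l in α..β, g l) :
    hF.stieltjesFunction.measure.restrict (Ioo A B)
      = (volume.restrict (Ioo A B)).withDensity fun t => ENNReal.ofReal (g t) := by
  have hFc : ∀ t ∈ Ioo A B, hF.stieltjesFunction t = F t := fun t ht =>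
    stieltjesFunction_apply_of_continuousAt hF (hasDerivAt_of_increment hg hinc ht).continuousAt
  set ν := (volume.restrict (Ioo A B)).withDensity fun t => ENNReal.ofReal (g t) with hν
  have hIoc : ∀ α ∈ Ioo A B, ∀ β ∈ Ioo A B, α ≤ β →
      hF.stieltjesFunction.measure (Ioc α β) = ν (Ioc α β) := by
    intro α hα β hβ h
    have hsub : Ioc α β ⊆ Ioo A B := fun s hs => ⟨hα.1.trans hs.1, hs.2.trans_lt hβ.2⟩
    have hint : IntervalIntegrable g volume α β :=
      (hg.mono (ordConnected_Ioo.uIcc_subset hα hβ)).intervalIntegrable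
    rw [StieltjesFunction.measure_Ioc, hFc α hα, hFc β hβ, hinc α hα β hβ h, hν,
      withDensity_apply _ measurableSet_Ioc, Measure.restrict_restrict measurableSet_Ioc,
      inter_eq_left.2 hsub, intervalIntegral.integral_of_le h]
    rw [ofReal_integral_eq_lintegral_ofReal hint.1]
    exact ae_restrict_of_forall_mem measurableSet_Ioc fun s hs => hg0 s (hsub hs)
  obtain ⟨u, -, hu, hutend⟩ := exists_seq_strictAnti_tendsto' hAB
  obtain ⟨v, -, hv, hvtend⟩ := exists_seq_strictMono_tendsto' hAB
  have hU : Ioo A B = ⋃ n, Ioc (u n) (v n) := by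
    ext s
    simp only [mem_iUnion]
    constructor
    · intro hs
      obtain ⟨n, hn⟩ := ((hutend.eventually_lt_const hs.1).and
        (hvtend.eventually_const_lt hs.2)).exists
      exact ⟨n, hn.1, hn.2.le⟩
    · rintro ⟨n, hn⟩
      exact ⟨(hu n).1.trans hn.1, hn.2.trans_lt (hv n).2⟩
  have hν' : ν.restrict (Ioo A B) = ν := by
    rw [hν, restrict_withDensity measurableSet_Ioo, Measure.restrict_restrict measurableSet_Ioo,
      inter_self]
  rw [← hν', hU, Measure.restrict_iUnion_congr]
  intro n
  have hfin : IsFiniteMeasure (hF.stieltjesFunction.measure.restrict (Ioc (u n) (v n))) :=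
    ⟨by
      rw [Measure.restrict_apply_univ, StieltjesFunction.measure_Ioc]
      exact ENNReal.ofReal_lt_top⟩
  have hgen : ∀ a b, a < b →
      hF.stieltjesFunction.measure.restrict (Ioc (u n) (v n)) (Ioc a b)
        = ν.restrict (Ioc (u n) (v n)) (Ioc a b) := by
    intro a b _
    rw [Measure.restrict_apply measurableSet_Ioc, Measure.restrict_apply measurableSet_Ioc,
      Ioc_inter_Ioc]
    rcases le_total (max a (u n)) (min b (v n)) with h | h
    · have h1 : max a (u n) ∈ Ioo A B :=
        ⟨(hu n).1.trans_le (le_max_right _ _), (h.trans (min_le_right _ _)).trans_lt (hv n).2⟩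
      have h2 : min b (v n) ∈ Ioo A B :=
        ⟨h1.1.trans_le h, (min_le_right _ _).trans_lt (hv n).2⟩
      exact hIoc _ h1 _ h2 h
    · simp [Ioc_eq_empty_of_le h]
  refine Measure.ext_of_Ioc_finite _ _ ?_ fun a b hab => hgen a b hab
  rw [Measure.restrict_apply_univ, Measure.restrict_apply_univ]
  rcases le_total (u n) (v n) with h | h
  · exact hIoc _ (hu n) _ (hv n) h
  · simp [Ioc_eq_empty_of_le h]

end SpectralDensity

/-! ### Absolute continuity from a dense span -/

section AbsoluteContinuity

variable {E : Type*} [NormedAddCommGroup E] [InnerProductSpace ℂ E] [CompleteSpace E]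

theorem spectralMeasure_univ_le (T : E →L[ℂ] E) (x : E) :
    spectralMeasure T x univ ≤ ENNReal.ofReal (‖x‖ ^ 2) := by
  have hb : ∀ t, (spectralFamily_mono T x).stieltjesFunction t ≤ ‖x‖ ^ 2 := by
    intro t
    rw [Monotone.stieltjesFunction_eq]
    refine ((spectralFamily_mono T x).rightLim_le (lt_add_one t)).trans ?_
    rw [re_inner_spectralFamily]
    gcongr
    exact Submodule.norm_starProjection_apply_le _ _
  have h0 : ∀ t, 0 ≤ (spectralFamily_mono T x).stieltjesFunction t := by
    intro t
    rw [Monotone.stieltjesFunction_eq]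
    refine le_trans ?_ ((spectralFamily_mono T x).le_rightLim le_rfl)
    rw [re_inner_spectralFamily]
    positivity
  have hU : (univ : Set ℝ) = ⋃ n : ℕ, Ioc (-(n : ℝ)) n := by
    symm
    rw [eq_univ_iff_forall]
    intro s
    obtain ⟨n, hn⟩ := exists_nat_gt |s|
    exact mem_iUnion.2 ⟨n, by linarith [neg_abs_le s], by linarith [le_abs_self s]⟩
  have hmono : Monotone fun n : ℕ => Ioc (-(n : ℝ)) n := by
    intro m n h
    have : (m : ℝ) ≤ n := by exact_mod_cast h
    exact Ioc_subset_Ioc (neg_le_neg this) this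
  rw [hU, hmono.measure_iUnion]
  refine iSup_le fun n => ?_
  rw [spectralMeasure, StieltjesFunction.measure_Ioc]
  refine ENNReal.ofReal_le_ofReal ?_
  linarith [hb n, h0 (-n)]

theorem spectralMeasure_parallelogram (T : E →L[ℂ] E) (x y : E) :
    spectralMeasure T (x + y) + spectralMeasure T (x - y)
      = (2 : NNReal) • (spectralMeasure T x + spectralMeasure T y) := by
  unfold spectralMeasure
  rw [← StieltjesFunction.measure_add, ← StieltjesFunction.measure_add,
    ← StieltjesFunction.measure_smul]
  congr 1
  ext t
  have key : ∀ s, (inner ℂ (x + y) (spectralFamily T s (x + y))).re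
      + (inner ℂ (x - y) (spectralFamily T s (x - y))).re
      = 2 * ((inner ℂ x (spectralFamily T s x)).re + (inner ℂ y (spectralFamily T s y)).re) := by
    intro s
    simp only [map_add, map_sub, inner_add_left, inner_add_right, inner_sub_left,
      inner_sub_right, Complex.add_re, Complex.sub_re]
    ring
  -- The Stieltjes function is the right limit of the quadratic form, so the pointwise identity is
  -- passed to right limits.
  have ht := fun z => (spectralFamily_mono T z).tendsto_rightLim t
  have h1 := (ht (x + y)).add (ht (x - y))
  have h2 := ((ht x).add (ht y)).const_mul 2
  simp only [key] at h1
  have := tendsto_nhds_unique h1 h2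
  exact this

theorem spectralMeasure_smul (T : E →L[ℂ] E) (c : ℂ) (x : E) :
    spectralMeasure T (c • x) = (‖c‖₊ ^ 2) • spectralMeasure T x := by
  unfold spectralMeasure
  rw [← StieltjesFunction.measure_smul]
  congr 1
  ext t
  have key : ∀ s, (inner ℂ (c • x) (spectralFamily T s (c • x))).re
      = ‖c‖ ^ 2 * (inner ℂ x (spectralFamily T s x)).re := by
    intro s
    rw [re_inner_spectralFamily, re_inner_spectralFamily, map_smul, norm_smul]
    ring
  have ht := fun z => (spectralFamily_mono T z).tendsto_rightLim t
  have h1 := ht (c • x)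
  have h2 := (ht x).const_mul (‖c‖ ^ 2)
  simp only [key] at h1
  have := tendsto_nhds_unique h1 h2
  rw [Monotone.stieltjesFunction_eq, funext key]
  exact this

/-- The parallelogram law with the measure of x - y dropped; it plays the role of a triangle
inequality. -/
theorem spectralMeasure_add_apply_le (T : E →L[ℂ] E) (x y : E) (s : Set ℝ) :
    spectralMeasure T (x + y) s ≤ 2 * (spectralMeasure T x s + spectralMeasure T y s) := by
  have h := congrArg (fun μ : Measure ℝ => μ s) (spectralMeasure_parallelogram T x y)
  simp only [Measure.add_apply, Measure.smul_apply] at h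
  refine le_self_add.trans (h.le.trans_eq ?_)
  rw [ENNReal.smul_def]
  simp

/-- The vectors whose spectral measures vanish on a given set form a closed subspace. -/
def spectralNull (T : E →L[ℂ] E) (s : Set ℝ) : Submodule ℂ E where
  carrier := {x | spectralMeasure T x s = 0}
  add_mem' {x y} hx hy := by
    have h := spectralMeasure_add_apply_le T x y s
    rw [mem_ofPred_eq] at hx hy
    rw [hx, hy] at h
    simpa using h
  zero_mem' := by
    have h := (measure_mono (subset_univ s)).trans (spectralMeasure_univ_le T 0)
    simpa using h
  smul_mem' c x hx := by
    rw [mem_ofPred_eq] at hx ⊢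
    rw [spectralMeasure_smul, Measure.smul_apply, hx, smul_zero]

/-- If μ_u(s) = 0, then μ_x(s) is at most twice the total mass of μ_{x-u}, which is at most 2‖x -
u‖². -/
theorem isClosed_spectralNull (T : E →L[ℂ] E) (s : Set ℝ) :
    IsClosed (spectralNull T s : Set E) := by
  refine isClosed_of_closure_subset fun x hx => ?_
  rw [mem_closure_iff_seq_limit] at hx
  obtain ⟨u, hu, hlim⟩ := hx
  have hbound : ∀ n, spectralMeasure T x s ≤ 2 * ENNReal.ofReal (‖x - u n‖ ^ 2) := by
    intro n
    have h := spectralMeasure_add_apply_le T (x - u n) (u n) s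
    have hun : spectralMeasure T (u n) s = 0 := hu n
    rw [sub_add_cancel, hun, add_zero] at h
    exact h.trans (mul_le_mul_right ((measure_mono (subset_univ s)).trans
      (spectralMeasure_univ_le T _)) 2)
  have h1 : Tendsto (fun n => ‖x - u n‖ ^ 2) atTop (𝓝 0) := by
    simpa using ((tendsto_const_nhds (x := x)).sub hlim).norm.pow 2
  have h2 : Tendsto (fun n => 2 * ENNReal.ofReal (‖x - u n‖ ^ 2)) atTop (𝓝 0) := by
    simpa using ENNReal.Tendsto.const_mul (a := 2) (ENNReal.tendsto_ofReal h1) (Or.inr (by simp))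
  exact le_antisymm (ge_of_tendsto' h2 hbound) bot_le

theorem isSpectrallyACOn_of_dense (T : E →L[ℂ] E) {S : Set ℝ} (hS : MeasurableSet S) (D : Set E)
    (hD : (Submodule.span ℂ D).topologicalClosure = ⊤)
    (h : ∀ x ∈ D, (spectralMeasure T x).restrict S ≪ volume) : IsSpectrallyACOn T S := by
  intro x N hN
  rw [Measure.restrict_apply' hS]
  have h1 : Submodule.span ℂ D ≤ spectralNull T (N ∩ S) := by
    rw [Submodule.span_le]
    intro y hy
    have := h y hy hN
    rwa [Measure.restrict_apply' hS] at this
  have h2 : (⊤ : Submodule ℂ E) ≤ spectralNull T (N ∩ S) := by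
    rw [← hD]
    exact Submodule.topologicalClosure_minimal _ h1 (isClosed_spectralNull T _)
  exact h2 (Submodule.mem_top (x := x))

end AbsoluteContinuity

/-! ### Backward recursions with summable perturbation -/

section BackwardRecursion

variable {V : Type*} [NormedAddCommGroup V] [NormedSpace ℂ V]

/-- The product `T_k T_{k+1} ⋯ T_{k+j-1}` applied to a vector. -/
def backProd (T : ℕ → V →L[ℂ] V) : ℕ → ℕ → V → V
  | _, 0, v => v
  | k, j + 1, v => T k (backProd T (k + 1) j v)

/-- The solution of `y_k = T_k y_{k+1}` that tends to `v₀`, as a telescoping series. -/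
def backSol (T : ℕ → V →L[ℂ] V) (v₀ : V) (k : ℕ) : V :=
  v₀ + ∑' j, backProd T k j (T (k + j) v₀ - v₀)

/-- The operators `T_k` are summable perturbations of contractions that fix `v₀`. -/
structure IsSummablePerturbation (T : ℕ → V →L[ℂ] V) (v₀ : V) (e : ℕ → ℝ) : Prop where
  nonneg : ∀ k, 0 ≤ e k
  summable : Summable e
  norm_le : ∀ k v, ‖T k v‖ ≤ (1 + e k) * ‖v‖
  norm_sub_le : ∀ k, ‖T k v₀ - v₀‖ ≤ e k

variable {T : ℕ → V →L[ℂ] V} {v₀ : V} {e : ℕ → ℝ}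

/-- Each factor costs 1 + e_i ≤ exp(e_i), so all products share one bound, independent of the
starting index and the length. -/
theorem IsSummablePerturbation.norm_backProd_le (h : IsSummablePerturbation T v₀ e) (k j : ℕ)
    (v : V) : ‖backProd T k j v‖ ≤ Real.exp (∑' i, e i) * ‖v‖ := by
  have h1 : ∀ j k, ‖backProd T k j v‖ ≤ Real.exp (∑ i ∈ Finset.range j, e (k + i)) * ‖v‖ := by
    intro j
    induction j with
    | zero => intro k; simp [backProd]
    | succ j ih =>
      intro k
      calc ‖T k (backProd T (k + 1) j v)‖ ≤ (1 + e k) * ‖backProd T (k + 1) j v‖ := h.norm_le _ _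
        _ ≤ Real.exp (e k) * (Real.exp (∑ i ∈ Finset.range j, e (k + 1 + i)) * ‖v‖) := by
            gcongr
            · linarith [Real.add_one_le_exp (e k)]
            · exact ih (k + 1)
        _ = Real.exp (∑ i ∈ Finset.range (j + 1), e (k + i)) * ‖v‖ := by
            rw [Finset.sum_range_succ', add_comm (∑ i ∈ Finset.range j, e (k + (i + 1))),
              Real.exp_add, add_zero]
            simp only [add_assoc, add_comm 1, mul_assoc]
  refine (h1 j k).trans ?_
  gcongr
  rw [← Finset.sum_image (s := Finset.range j) (g := fun i => k + i) (f := e)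
    (fun x _ y _ hxy => by simpa using hxy)]
  exact h.summable.sum_le_tsum _ fun i _ => h.nonneg i

theorem IsSummablePerturbation.norm_term_le (h : IsSummablePerturbation T v₀ e) (k j : ℕ) :
    ‖backProd T k j (T (k + j) v₀ - v₀)‖ ≤ Real.exp (∑' i, e i) * e (k + j) :=
  (h.norm_backProd_le k j _).trans (by gcongr; exact h.norm_sub_le _)

theorem IsSummablePerturbation.summable_bound (h : IsSummablePerturbation T v₀ e) (k : ℕ) :
    Summable fun j => Real.exp (∑' i, e i) * e (k + j) := by
  have : Summable fun j => e (k + j) := by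
    simpa only [add_comm k] using (summable_nat_add_iff k).2 h.summable
  exact this.mul_left _

theorem IsSummablePerturbation.norm_backSol_sub_le (h : IsSummablePerturbation T v₀ e) (k : ℕ) :
    ‖backSol T v₀ k - v₀‖ ≤ Real.exp (∑' i, e i) * ∑' j, e (k + j) := by
  unfold backSol
  rw [add_sub_cancel_left, ← tsum_mul_left]
  exact tsum_of_norm_bounded (h.summable_bound k).hasSum (h.norm_term_le k)

variable [CompleteSpace V]

theorem IsSummablePerturbation.summable_term (h : IsSummablePerturbation T v₀ e) (k : ℕ) :
    Summable fun j => backProd T k j (T (k + j) v₀ - v₀) :=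
  Summable.of_norm_bounded (h.summable_bound k) (h.norm_term_le k)

theorem IsSummablePerturbation.backSol_eq (h : IsSummablePerturbation T v₀ e) (k : ℕ) :
    backSol T v₀ k = T k (backSol T v₀ (k + 1)) := by
  unfold backSol
  rw [(h.summable_term k).tsum_eq_zero_add, map_add, (T k).map_tsum (h.summable_term (k + 1))]
  simp only [backProd, add_zero, add_assoc, add_comm 1]
  abel

/-- The sequence `e` does not depend on the parameter, so the Weierstrass test applies on all of
`S`. -/
theorem continuousOn_backSol {X : Type*} [TopologicalSpace X] {S : Set X}
    {T : X → ℕ → V →L[ℂ] V} (h : ∀ x ∈ S, IsSummablePerturbation (T x) v₀ e)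
    (hc : ∀ (k : ℕ) (v : X → V), ContinuousOn v S → ContinuousOn (fun x => T x k (v x)) S)
    (k : ℕ) : ContinuousOn (fun x => backSol (T x) v₀ k) S := by
  rcases S.eq_empty_or_nonempty with rfl | ⟨x₀, hx₀⟩
  · exact continuousOn_empty _
  have hprod : ∀ (j k : ℕ) (v : X → V), ContinuousOn v S →
      ContinuousOn (fun x => backProd (T x) k j (v x)) S := by
    intro j
    induction j with
    | zero => intro k v hv; exact hv
    | succ j ih => intro k v hv; exact hc k _ (ih (k + 1) v hv)
  refine continuousOn_const.add (continuousOn_tsum (fun j => ?_) ((h x₀ hx₀).summable_bound k)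
    fun j x hx => (h x hx).norm_term_le k j)
  exact hprod j k _ ((hc _ _ continuousOn_const).sub continuousOn_const)

end BackwardRecursion

/-! ### The Jost solution in the variable ζ -/

section JostSequence

variable (a b : ℕ → ℝ)

/-- The size of the perturbation entering the `k`-th step of the backward recursion. -/
def stepDefect (k : ℕ) : ℝ := |a k - 1 / 2| + |prevCoeff a k - 1 / 2| + |b k|

/-- The coefficient `2ζ / (1 - ζ²)` that diagonalises the unperturbed recursion. -/
def diagCoeff (ζ : ℂ) : ℂ := 2 * ζ / (1 - ζ ^ 2)

/-- The inhomogeneity coefficient of the recursion for `f_n ζ^{-n}`. -/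
def perturbCoeff (ζ : ℂ) (k : ℕ) : ℂ :=
  (1 / 2 - a k) * ζ + (1 / 2 - prevCoeff a k) * ζ⁻¹ - b k

/-- The backward transfer matrix in coordinates that diagonalise the unperturbed recursion. -/
def jostStep (ζ : ℂ) (k : ℕ) : ℂ × ℂ →L[ℂ] ℂ × ℂ :=
  (ContinuousLinearMap.fst ℂ ℂ ℂ + (ζ / a k - 2 * ζ) • ContinuousLinearMap.snd ℂ ℂ ℂ
      + (diagCoeff ζ * perturbCoeff a b ζ k) • (ContinuousLinearMap.fst ℂ ℂ ℂ
        + (ζ / a k - diagCoeff ζ) • ContinuousLinearMap.snd ℂ ℂ ℂ)).prod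
    (ζ ^ 2 • ContinuousLinearMap.snd ℂ ℂ ℂ
      + perturbCoeff a b ζ k • (ContinuousLinearMap.fst ℂ ℂ ℂ
        + (ζ / a k - diagCoeff ζ) • ContinuousLinearMap.snd ℂ ℂ ℂ))

theorem jostStep_apply (ζ : ℂ) (k : ℕ) (v : ℂ × ℂ) :
    jostStep a b ζ k v =
      (v.1 + (ζ / a k - 2 * ζ) * v.2
        + diagCoeff ζ * perturbCoeff a b ζ k * (v.1 + (ζ / a k - diagCoeff ζ) * v.2),
      ζ ^ 2 * v.2 + perturbCoeff a b ζ k * (v.1 + (ζ / a k - diagCoeff ζ) * v.2)) := rfl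

/-- The solution of the diagonalised recursion with limit `(1, 0)`. -/
def jostVec (ζ : ℂ) (k : ℕ) : ℂ × ℂ := backSol (jostStep a b ζ) (1, 0) k

/-- The sequence `f_n ζ^{-n}` (index shifted by one) for the Jost solution `f`. -/
def jostRatio (ζ : ℂ) : ℕ → ℂ
  | 0 => (jostVec a b ζ 0).1 - diagCoeff ζ * (jostVec a b ζ 0).2 + 2 * ζ * (jostVec a b ζ 0).2
  | k + 1 => (jostVec a b ζ k).1 - diagCoeff ζ * (jostVec a b ζ k).2

/-- The Jost solution (index shifted by one) in terms of the uniformising variable `ζ`. -/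
def jostSeq (ζ : ℂ) (k : ℕ) : ℂ := ζ⁻¹ * ζ ^ k * jostRatio a b ζ k

/-- The part of the closed unit disc at distance from the singular points `0, 1, -1`. -/
def jostRegion (δ : ℝ) : Set ℂ := {ζ | δ ≤ ‖ζ‖ ∧ ‖ζ‖ ≤ 1 ∧ δ ≤ ‖1 - ζ ^ 2‖}

variable {a b}

theorem exists_pos_le_of_summable (ha : ∀ n, 0 < a n)
    (hab : Summable fun n => |a n - 1 / 2| + |b n|) : ∃ m : ℝ, 0 < m ∧ ∀ k, m ≤ a k := by
  have h1 : Tendsto (fun n => |a n - 1 / 2| + |b n|) atTop (𝓝 0) := hab.tendsto_atTop_zero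
  obtain ⟨N, hN⟩ := eventually_atTop.1 (h1.eventually_lt_const (by norm_num : (0 : ℝ) < 1 / 4))
  have hN' : ∀ n, N ≤ n → 1 / 4 ≤ a n := by
    intro n hn
    have h2 := hN n hn
    have h3 := neg_abs_le (a n - 1 / 2)
    linarith [abs_nonneg (b n)]
  have hne : (Finset.range (N + 1)).Nonempty := ⟨0, by simp⟩
  obtain ⟨i, _, hi⟩ := Finset.exists_min_image (Finset.range (N + 1)) a hne
  refine ⟨min (1 / 4) (a i), lt_min (by norm_num) (ha i), fun k => ?_⟩
  rcases le_total N k with h | h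
  · exact (min_le_left _ _).trans (hN' k h)
  · exact (min_le_right _ _).trans (hi k (by simp; omega))

theorem stepDefect_nonneg (k : ℕ) : 0 ≤ stepDefect a b k := by
  unfold stepDefect
  positivity

theorem stepDefect_succ_le (k : ℕ) : stepDefect a b (k + 1)
    ≤ (|a (k + 1) - 1 / 2| + |b (k + 1)|) + (|a k - 1 / 2| + |b k|) := by
  unfold stepDefect prevCoeff
  linarith [abs_nonneg (b k)]

theorem summable_stepDefect (hab : Summable fun n => |a n - 1 / 2| + |b n|) :
    Summable (stepDefect a b) := by
  rw [← summable_nat_add_iff 1]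
  exact Summable.of_nonneg_of_le (fun k => stepDefect_nonneg _) stepDefect_succ_le
    (((summable_nat_add_iff 1).2 hab).add hab)

/-- The defect at k involves both a_k and a_{k-1}. Starting at n + 1 keeps all indices ≥ n, and each
term of the tail is used at most twice. -/
theorem tsum_stepDefect_le (hab : Summable fun n => |a n - 1 / 2| + |b n|) (n : ℕ) :
    ∑' j, stepDefect a b (n + 1 + j) ≤ 2 * coeffTail a b n := by
  have hs : ∀ n, Summable fun j => |a (n + j) - 1 / 2| + |b (n + j)| := fun n => by
    simpa only [add_comm n] using (summable_nat_add_iff n).2 hab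
  have h1 : Summable fun j => stepDefect a b (n + 1 + j) := by
    simpa only [add_comm (n + 1)] using
      (summable_nat_add_iff (n + 1)).2 (summable_stepDefect hab)
  have h2 : ∀ j, stepDefect a b (n + 1 + j) ≤
      (|a (n + (j + 1)) - 1 / 2| + |b (n + (j + 1))|) + (|a (n + j) - 1 / 2| + |b (n + j)|) := by
    intro j
    have := stepDefect_succ_le (a := a) (b := b) (n + j)
    rwa [show n + j + 1 = n + 1 + j by ring, ← show n + (j + 1) = n + 1 + j by ring] at *
  have h3 := (summable_nat_add_iff 1).2 (hs n)
  calc ∑' j, stepDefect a b (n + 1 + j) ≤ _ := h1.tsum_le_tsum h2 (h3.add (hs n))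
    _ = ∑' j, (|a (n + (j + 1)) - 1 / 2| + |b (n + (j + 1))|)
        + ∑' j, (|a (n + j) - 1 / 2| + |b (n + j)|) := h3.tsum_add (hs n)
    _ ≤ 2 * coeffTail a b n := by
        have h4 := (hs n).tsum_eq_zero_add
        unfold coeffTail
        have h5 : 0 ≤ |a (n + 0) - 1 / 2| + |b (n + 0)| := by positivity
        linarith

variable {δ m : ℝ} {ζ : ℂ}

theorem norm_diagCoeff_le (hδ : 0 < δ) (hζ : ζ ∈ jostRegion δ) : ‖diagCoeff ζ‖ ≤ 2 / δ := by
  rw [diagCoeff, norm_div, norm_mul, Complex.norm_ofNat]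
  gcongr
  · linarith [hζ.2.1]
  · exact hζ.2.2

theorem norm_ofReal_sub_half (r : ℝ) : ‖(1 / 2 - r : ℂ)‖ = |r - 1 / 2| := by
  have h : (1 / 2 - r : ℂ) = ((1 / 2 - r : ℝ) : ℂ) := by push_cast; rfl
  rw [h, Complex.norm_real, Real.norm_eq_abs, abs_sub_comm]

theorem norm_perturbCoeff_le (hδ : 0 < δ) (hζ : ζ ∈ jostRegion δ) (k : ℕ) :
    ‖perturbCoeff a b ζ k‖ ≤ (1 + 1 / δ) * stepDefect a b k := by
  have h1 : ‖ζ⁻¹‖ ≤ 1 / δ := by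
    rw [norm_inv, ← one_div]
    gcongr
    exact hζ.1
  calc ‖perturbCoeff a b ζ k‖
      ≤ ‖(1 / 2 - a k : ℂ)‖ * ‖ζ‖ + ‖(1 / 2 - prevCoeff a k : ℂ)‖ * ‖ζ⁻¹‖ + ‖(b k : ℂ)‖ := by
        unfold perturbCoeff
        refine (norm_sub_le _ _).trans ?_
        gcongr
        refine (norm_add_le _ _).trans ?_
        rw [norm_mul, norm_mul]
    _ ≤ |a k - 1 / 2| * 1 + |prevCoeff a k - 1 / 2| * (1 / δ) + |b k| := by
        rw [norm_ofReal_sub_half, norm_ofReal_sub_half, Complex.norm_real, Real.norm_eq_abs]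
        gcongr
        exact hζ.2.1
    _ ≤ _ := by
        unfold stepDefect
        have : 0 < 1 / δ := by positivity
        nlinarith [abs_nonneg (a k - 1 / 2), abs_nonneg (prevCoeff a k - 1 / 2), abs_nonneg (b k)]

theorem norm_div_sub_two_mul_le (hm : 0 < m) (hma : ∀ k, m ≤ a k) (hζ : ζ ∈ jostRegion δ)
    (k : ℕ) : ‖ζ / a k - 2 * ζ‖ ≤ 2 / m * stepDefect a b k := by
  have hak : 0 < a k := hm.trans_le (hma k)
  have hne : (a k : ℂ) ≠ 0 := by exact_mod_cast hak.ne'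
  have h1 : ζ / a k - 2 * ζ = ζ * (2 / a k) * (1 / 2 - a k : ℂ) := by
    field_simp
  rw [h1, norm_mul, norm_mul, norm_ofReal_sub_half, norm_div, Complex.norm_ofNat, Complex.norm_real,
    Real.norm_of_nonneg hak.le]
  have h2 : |a k - 1 / 2| ≤ stepDefect a b k := by
    unfold stepDefect
    linarith [abs_nonneg (prevCoeff a k - 1 / 2), abs_nonneg (b k)]
  calc ‖ζ‖ * (2 / a k) * |a k - 1 / 2| ≤ 1 * (2 / m) * stepDefect a b k := by
        gcongr
        · exact hζ.2.1
        · exact hma k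
    _ = _ := by ring

theorem norm_div_sub_diagCoeff_le (hm : 0 < m) (hma : ∀ k, m ≤ a k) (hδ : 0 < δ)
    (hζ : ζ ∈ jostRegion δ) (k : ℕ) : ‖ζ / a k - diagCoeff ζ‖ ≤ 1 / m + 2 / δ := by
  have hak : 0 < a k := hm.trans_le (hma k)
  refine (norm_sub_le _ _).trans (add_le_add ?_ (norm_diagCoeff_le hδ hζ))
  rw [norm_div, Complex.norm_real, Real.norm_of_nonneg hak.le]
  gcongr
  · exact hζ.2.1
  · exact hma k

/-- The constant in the estimates for the backward recursion. -/
def stepConst (m δ : ℝ) : ℝ := 2 / m + (2 / δ + 1) * (1 + 1 / δ) * (1 + 1 / m + 2 / δ)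

theorem stepConst_nonneg (hm : 0 < m) (hδ : 0 < δ) : 0 ≤ stepConst m δ := by
  unfold stepConst
  positivity

/-- For the free coefficients the step is diag(1, ζ²), which is contractive in the sup norm for |ζ|
≤ 1 and fixes (1, 0). Every other term carries a factor a_k - 1/2 or `perturbCoeff`; the bounds |ζ|
≥ δ and |1 - ζ²| ≥ δ control ζ⁻¹ and `diagCoeff`. -/
theorem isSummablePerturbation_jostStep (hab : Summable fun n => |a n - 1 / 2| + |b n|)
    (hm : 0 < m) (hma : ∀ k, m ≤ a k) (hδ : 0 < δ) (hζ : ζ ∈ jostRegion δ) :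
    IsSummablePerturbation (jostStep a b ζ) (1, 0)
      (fun k => stepConst m δ * stepDefect a b k) where
  nonneg k := mul_nonneg (stepConst_nonneg hm hδ) (stepDefect_nonneg k)
  summable := (summable_stepDefect hab).mul_left _
  norm_le k v := by
    have hd := stepDefect_nonneg (a := a) (b := b) k
    have h1 : ‖v.1‖ ≤ ‖v‖ := norm_fst_le v
    have h2 : ‖v.2‖ ≤ ‖v‖ := norm_snd_le v
    have hG : ‖v.1 + (ζ / a k - diagCoeff ζ) * v.2‖ ≤ (1 + 1 / m + 2 / δ) * ‖v‖ := by
      refine (norm_add_le _ _).trans ?_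
      rw [norm_mul]
      calc ‖v.1‖ + ‖ζ / a k - diagCoeff ζ‖ * ‖v.2‖ ≤ ‖v‖ + (1 / m + 2 / δ) * ‖v‖ := by
            gcongr
            exact norm_div_sub_diagCoeff_le hm hma hδ hζ k
        _ = _ := by ring
    have hcG : ‖perturbCoeff a b ζ k * (v.1 + (ζ / a k - diagCoeff ζ) * v.2)‖
        ≤ (1 + 1 / δ) * stepDefect a b k * ((1 + 1 / m + 2 / δ) * ‖v‖) := by
      rw [norm_mul]
      gcongr
      exact norm_perturbCoeff_le hδ hζ k
    have hdiag := norm_diagCoeff_le hδ hζ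
    -- R bounds the perturbation term; it enters the second coordinate once and the first with the
    -- factor |`diagCoeff ζ`| ≤ 2/δ. With the 2/m from ζ/a_k - 2ζ this accounts for `stepConst`.
    set R := (1 + 1 / δ) * stepDefect a b k * ((1 + 1 / m + 2 / δ) * ‖v‖) with hR
    have hR0 : 0 ≤ R := by positivity
    have hC : (1 + stepConst m δ * stepDefect a b k) * ‖v‖
        = ‖v‖ + 2 / m * stepDefect a b k * ‖v‖ + (2 / δ * R + R) := by
      rw [hR, stepConst]
      ring
    rw [jostStep_apply, Prod.norm_def, hC]
    refine max_le ?_ ?_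
    · refine (norm_add_le _ _).trans (add_le_add ?_ ?_)
      · refine (norm_add_le _ _).trans (add_le_add h1 ?_)
        rw [norm_mul]
        gcongr
        exact norm_div_sub_two_mul_le hm hma hζ k
      · rw [mul_assoc, norm_mul]
        calc _ ≤ 2 / δ * R := by gcongr
          _ ≤ _ := by linarith
    · refine (norm_add_le _ _).trans ?_
      have h3 : ‖ζ ^ 2 * v.2‖ ≤ ‖v‖ := by
        rw [norm_mul, norm_pow]
        calc ‖ζ‖ ^ 2 * ‖v.2‖ ≤ 1 * ‖v‖ := by
              gcongr
              exact pow_le_one₀ (norm_nonneg _) hζ.2.1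
          _ = _ := one_mul _
      have h4 : 0 ≤ 2 / m * stepDefect a b k * ‖v‖ := by positivity
      have h5 : 0 ≤ 2 / δ * R := by positivity
      linarith
  norm_sub_le k := by
    have hd := stepDefect_nonneg (a := a) (b := b) k
    have hc := norm_perturbCoeff_le (a := a) (b := b) hδ hζ k
    have hdiag := norm_diagCoeff_le hδ hζ
    have hC : (2 / δ + 1) * ((1 + 1 / δ) * stepDefect a b k)
        ≤ stepConst m δ * stepDefect a b k := by
      rw [stepConst, ← mul_assoc]
      gcongr
      have h1 : 0 ≤ (2 / δ + 1) * (1 + 1 / δ) := by positivity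
      have h2 : 0 ≤ 1 / m + 2 / δ := by positivity
      have h3 : 0 ≤ 2 / m := by positivity
      nlinarith [mul_nonneg h1 h2]
    refine le_trans ?_ hC
    have hR : 0 ≤ (1 + 1 / δ) * stepDefect a b k := by positivity
    rw [jostStep_apply, Prod.norm_def]
    simp only [mul_zero, add_zero, mul_one, Prod.mk_sub_mk, add_sub_cancel_left, zero_add, sub_zero]
    refine max_le ?_ ?_
    · rw [norm_mul]
      calc _ ≤ 2 / δ * ((1 + 1 / δ) * stepDefect a b k) := by gcongr
        _ ≤ _ := by linarith
    · have : 0 ≤ 2 / δ * ((1 + 1 / δ) * stepDefect a b k) := by positivity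
      linarith

theorem ne_zero_of_mem_jostRegion (hδ : 0 < δ) (hζ : ζ ∈ jostRegion δ) : ζ ≠ 0 :=
  norm_pos_iff.1 (hδ.trans_le hζ.1)

theorem one_sub_sq_ne_zero_of_mem_jostRegion (hδ : 0 < δ) (hζ : ζ ∈ jostRegion δ) :
    1 - ζ ^ 2 ≠ 0 :=
  norm_pos_iff.1 (hδ.trans_le hζ.2.2)

theorem continuousOn_jostVec (hab : Summable fun n => |a n - 1 / 2| + |b n|)
    (hm : 0 < m) (hma : ∀ k, m ≤ a k) (hδ : 0 < δ) (k : ℕ) :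
    ContinuousOn (fun ζ => jostVec a b ζ k) (jostRegion δ) := by
  refine continuousOn_backSol
    (fun ζ hζ => isSummablePerturbation_jostStep hab hm hma hδ hζ) (fun k v hv => ?_) k
  have h0 : ∀ ζ ∈ jostRegion δ, ζ ≠ 0 := fun ζ => ne_zero_of_mem_jostRegion hδ
  have h1 : ∀ ζ ∈ jostRegion δ, 1 - ζ ^ 2 ≠ 0 := fun ζ => one_sub_sq_ne_zero_of_mem_jostRegion hδ
  simp only [jostStep_apply, perturbCoeff, diagCoeff]
  fun_prop (disch := assumption)

theorem continuousOn_jostSeq (hab : Summable fun n => |a n - 1 / 2| + |b n|)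
    (ha : ∀ n, 0 < a n) (hδ : 0 < δ) (k : ℕ) :
    ContinuousOn (fun ζ => jostSeq a b ζ k) (jostRegion δ) := by
  obtain ⟨m, hm, hma⟩ := exists_pos_le_of_summable ha hab
  have hv := continuousOn_jostVec hab hm hma hδ
  have h0 : ∀ ζ ∈ jostRegion δ, ζ ≠ 0 := fun ζ => ne_zero_of_mem_jostRegion hδ
  have h1 : ∀ ζ ∈ jostRegion δ, 1 - ζ ^ 2 ≠ 0 := fun ζ => one_sub_sq_ne_zero_of_mem_jostRegion hδ
  unfold jostSeq
  cases k with
  | zero =>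
    have := hv 0
    simp only [jostRatio, diagCoeff]
    fun_prop (disch := assumption)
  | succ k =>
    have := hv k
    simp only [jostRatio, diagCoeff]
    fun_prop (disch := assumption)

/-- This identifies the second coordinate of `jostVec` as a_{k-1} ζ⁻¹ times the difference of
consecutive values of f_n ζ⁻ⁿ. At k = 0 it holds by the choice of `jostRatio` there, as 2ζ =
ζ/a_{-1}. -/
theorem jostRatio_eq (hab : Summable fun n => |a n - 1 / 2| + |b n|)
    (ha : ∀ n, 0 < a n) (hδ : 0 < δ) (hζ : ζ ∈ jostRegion δ) (k : ℕ) :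
    jostRatio a b ζ k = jostRatio a b ζ (k + 1) + ζ / prevCoeff a k * (jostVec a b ζ k).2 := by
  obtain ⟨m, hm, hma⟩ := exists_pos_le_of_summable ha hab
  cases k with
  | zero =>
    simp only [jostRatio, prevCoeff]
    push_cast
    ring
  | succ k =>
    have h := (isSummablePerturbation_jostStep hab hm hma hδ hζ).backSol_eq k
    change jostVec a b ζ k = jostStep a b ζ k (jostVec a b ζ (k + 1)) at h
    have h1 := one_sub_sq_ne_zero_of_mem_jostRegion hδ hζ
    -- This relation determines `diagCoeff`: it is what decouples the first coordinate in the free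
    -- recursion.
    have hκ : diagCoeff ζ * ζ ^ 2 + 2 * ζ = diagCoeff ζ := by
      unfold diagCoeff
      field_simp
      ring
    simp only [jostRatio, prevCoeff]
    rw [h, jostStep_apply]
    linear_combination (-(jostVec a b ζ (k + 1)).2) * hκ

theorem jostVec_snd_eq (hab : Summable fun n => |a n - 1 / 2| + |b n|)
    (ha : ∀ n, 0 < a n) (hδ : 0 < δ) (hζ : ζ ∈ jostRegion δ) (k : ℕ) :
    (jostVec a b ζ k).2 = ζ ^ 2 * (jostVec a b ζ (k + 1)).2
      + perturbCoeff a b ζ k * jostRatio a b ζ (k + 1) := by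
  obtain ⟨m, hm, hma⟩ := exists_pos_le_of_summable ha hab
  have h := (isSummablePerturbation_jostStep hab hm hma hδ hζ).backSol_eq k
  change jostVec a b ζ k = jostStep a b ζ k (jostVec a b ζ (k + 1)) at h
  have h2 := jostRatio_eq hab ha hδ hζ (k + 1)
  rw [h2, h, jostStep_apply]
  simp only [jostRatio, prevCoeff]
  ring

theorem prevCoeff_pos (ha : ∀ n, 0 < a n) (k : ℕ) : 0 < prevCoeff a k := by
  cases k with
  | zero => simp [prevCoeff]
  | succ k => exact ha k

/-- Eliminating the second coordinate between `jostRatio_eq` and `jostVec_snd_eq` leaves a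
three-term relation for the ratios, which is the Jacobi equation divided by a power of ζ. -/
theorem solvesJacobi_jostSeq (hab : Summable fun n => |a n - 1 / 2| + |b n|)
    (ha : ∀ n, 0 < a n) (hδ : 0 < δ) (hζ : ζ ∈ jostRegion δ) {z : ℂ}
    (hz : 2 * z * ζ = ζ ^ 2 + 1) : SolvesJacobi a b z (jostSeq a b ζ) := by
  intro n
  have h0 := ne_zero_of_mem_jostRegion hδ hζ
  have hp : (prevCoeff a n : ℂ) ≠ 0 := by exact_mod_cast (prevCoeff_pos ha n).ne'
  have hp' : (a n : ℂ) ≠ 0 := by exact_mod_cast (ha n).ne'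
  have e1 := jostRatio_eq hab ha hδ hζ n
  have e2 := jostRatio_eq hab ha hδ hζ (n + 1)
  have e3 := jostVec_snd_eq hab ha hδ hζ n
  simp only [prevCoeff] at e2
  have hz' : z = (ζ + ζ⁻¹) / 2 := by
    field_simp
    linear_combination hz
  have e2' : (jostVec a b ζ (n + 1)).2 * ζ
      = a n * (jostRatio a b ζ (n + 1) - jostRatio a b ζ (n + 2)) := by
    rw [e2]
    field_simp
    ring
  have e1' : (jostVec a b ζ n).2 * ζ
      = prevCoeff a n * (jostRatio a b ζ n - jostRatio a b ζ (n + 1)) := by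
    rw [e1]
    field_simp
    ring
  rw [perturbCoeff] at e3
  simp only [jostSeq]
  rw [hz']
  generalize jostRatio a b ζ n = g0 at *
  generalize jostRatio a b ζ (n + 1) = g1 at *
  generalize jostRatio a b ζ (n + 2) = g2 at *
  generalize (jostVec a b ζ n).2 = y0 at *
  generalize (jostVec a b ζ (n + 1)).2 = y1 at *
  have key : prevCoeff a n * ζ⁻¹ * (g0 - g1) = ζ * (a n * (g1 - g2))
      + ((1 / 2 - a n) * ζ + (1 / 2 - prevCoeff a n) * ζ⁻¹ - b n) * g1 := by
    calc prevCoeff a n * ζ⁻¹ * (g0 - g1) = ζ⁻¹ * (y0 * ζ) := by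
          rw [e1']
          ring
      _ = y0 := by field_simp
      _ = _ := by
          rw [e3, ← e2']
          ring
  have hζi : ζ⁻¹ * ζ = 1 := inv_mul_cancel₀ h0
  rw [pow_succ, pow_succ]
  linear_combination (ζ ^ n) * key + (ζ ^ n * (b n * g1 + a n * ζ * g2 - (ζ + ζ⁻¹) / 2 * g1)) * hζi

theorem exists_norm_jostRatio_sub_one_le (hab : Summable fun n => |a n - 1 / 2| + |b n|)
    (ha : ∀ n, 0 < a n) (hδ : 0 < δ) (hζ : ζ ∈ jostRegion δ) :
    ∃ K : ℝ, ∀ n, ‖jostRatio a b ζ (n + 1) - 1‖ ≤ K * coeffTail a b n := by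
  obtain ⟨m, hm, hma⟩ := exists_pos_le_of_summable ha hab
  have hp := isSummablePerturbation_jostStep hab hm hma hδ hζ
  set S := Real.exp (∑' i, stepConst m δ * stepDefect a b i) with hS
  have hC := stepConst_nonneg hm hδ
  refine ⟨(1 + (1 / m + 2 / δ)) * (S * (stepConst m δ * 2)), fun n => ?_⟩
  have h1 := hp.norm_backSol_sub_le (n + 1)
  change ‖jostVec a b ζ (n + 1) - (1, 0)‖
    ≤ S * ∑' j, stepConst m δ * stepDefect a b (n + 1 + j) at h1
  rw [tsum_mul_left] at h1
  have h2 : ‖jostVec a b ζ (n + 1) - (1, 0)‖ ≤ S * (stepConst m δ * (2 * coeffTail a b n)) := by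
    refine h1.trans ?_
    gcongr
    exact tsum_stepDefect_le hab n
  have h3 : ‖(jostVec a b ζ (n + 1)).1 - 1‖ ≤ ‖jostVec a b ζ (n + 1) - (1, 0)‖ :=
    norm_fst_le (jostVec a b ζ (n + 1) - (1, 0))
  have h4 : ‖(jostVec a b ζ (n + 1)).2‖ ≤ ‖jostVec a b ζ (n + 1) - (1, 0)‖ := by
    have := norm_snd_le (jostVec a b ζ (n + 1) - (1, 0))
    rwa [Prod.snd_sub, sub_zero] at this
  -- The ratio is expressed through `jostVec` at n + 1 rather than at n: the defect at n involves
  -- a_{n-1}, which the tail ρ_n does not control.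
  have h5 : jostRatio a b ζ (n + 1) - 1 = ((jostVec a b ζ (n + 1)).1 - 1)
      + (ζ / a n - diagCoeff ζ) * (jostVec a b ζ (n + 1)).2 := by
    rw [jostRatio_eq hab ha hδ hζ (n + 1)]
    simp only [jostRatio, prevCoeff]
    ring
  rw [h5]
  refine (norm_add_le _ _).trans ?_
  rw [norm_mul]
  calc _ ≤ ‖jostVec a b ζ (n + 1) - (1, 0)‖
        + (1 / m + 2 / δ) * ‖jostVec a b ζ (n + 1) - (1, 0)‖ := by
        gcongr
        exact norm_div_sub_diagCoeff_le hm hma hδ hζ n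
    _ = (1 + (1 / m + 2 / δ)) * ‖jostVec a b ζ (n + 1) - (1, 0)‖ := by ring
    _ ≤ (1 + (1 / m + 2 / δ)) * (S * (stepConst m δ * (2 * coeffTail a b n))) := by gcongr
    _ = _ := by ring

theorem tendsto_coeffTail : Tendsto (coeffTail a b) atTop (𝓝 0) := by
  have := tendsto_sum_nat_add fun n => |a n - 1 / 2| + |b n|
  refine this.congr fun n => tsum_congr fun m => ?_
  rw [add_comm m n]

theorem tendsto_jostRatio (hab : Summable fun n => |a n - 1 / 2| + |b n|)
    (ha : ∀ n, 0 < a n) (hδ : 0 < δ) (hζ : ζ ∈ jostRegion δ) :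
    Tendsto (jostRatio a b ζ) atTop (𝓝 1) := by
  obtain ⟨K, hK⟩ := exists_norm_jostRatio_sub_one_le hab ha hδ hζ
  rw [← tendsto_add_atTop_iff_nat 1, tendsto_iff_norm_sub_tendsto_zero]
  refine squeeze_zero (fun n => norm_nonneg _) hK ?_
  simpa using tendsto_coeffTail.const_mul K

theorem mem_jostRegion (h0 : ζ ≠ 0) (h1 : ‖ζ‖ ≤ 1) (h2 : ζ ^ 2 ≠ 1) :
    ∃ δ : ℝ, 0 < δ ∧ ζ ∈ jostRegion δ := by
  have h3 : 0 < ‖1 - ζ ^ 2‖ := norm_pos_iff.2 (sub_ne_zero.2 h2.symm)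
  exact ⟨min ‖ζ‖ ‖1 - ζ ^ 2‖, lt_min (norm_pos_iff.2 h0) h3, min_le_left _ _, h1, min_le_right _ _⟩

end JostSequence

/-! ### The map ζ(z) and its boundary values -/

section ZetaFunction

theorem cpow_half_sq (w : ℂ) : (w ^ (1 / 2 : ℂ)) ^ 2 = w := by
  have h := Complex.cpow_nat_inv_pow w (n := 2) two_ne_zero
  rwa [Nat.cast_ofNat, ← one_div] at h

theorem sqrtZ_sq (z : ℂ) : sqrtZ z ^ 2 = z ^ 2 - 1 := by
  rw [sqrtZ, mul_pow, cpow_half_sq, cpow_half_sq]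
  ring

theorem two_mul_zetaFn (z : ℂ) : 2 * z * zetaFn z = zetaFn z ^ 2 + 1 := by
  unfold zetaFn
  linear_combination -sqrtZ_sq z

theorem zetaFn_ne_zero (z : ℂ) : zetaFn z ≠ 0 := by
  intro h
  have := two_mul_zetaFn z
  rw [h] at this
  simp at this

theorem zetaFn_sq_ne_one {z : ℂ} (hz : z ^ 2 ≠ 1) : zetaFn z ^ 2 ≠ 1 := by
  intro h
  have h1 := two_mul_zetaFn z
  apply hz
  have h2 : z * zetaFn z = 1 := by linear_combination h1 / 2 + h / 2
  calc z ^ 2 = z ^ 2 * zetaFn z ^ 2 := by rw [h, mul_one]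
    _ = (z * zetaFn z) ^ 2 := by ring
    _ = 1 := by rw [h2, one_pow]

theorem re_cpow_half (w : ℂ) :
    (w ^ (1 / 2 : ℂ)).re = ‖w‖ ^ (1 / 2 : ℝ) * Real.cos (w.arg * (1 / 2)) := by
  have h := Complex.cpow_ofReal_re w (1 / 2)
  push_cast at h
  exact h

theorem im_cpow_half (w : ℂ) :
    (w ^ (1 / 2 : ℂ)).im = ‖w‖ ^ (1 / 2 : ℝ) * Real.sin (w.arg * (1 / 2)) := by
  have h := Complex.cpow_ofReal_im w (1 / 2)
  push_cast at h
  exact h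

theorem re_cpow_half_nonneg (w : ℂ) : 0 ≤ (w ^ (1 / 2 : ℂ)).re := by
  rw [re_cpow_half]
  refine mul_nonneg (Real.rpow_nonneg (norm_nonneg _) _) (Real.cos_nonneg_of_mem_Icc ?_)
  constructor <;> linarith [Complex.neg_pi_lt_arg w, Complex.arg_le_pi w]

theorem im_cpow_half_nonneg {w : ℂ} (hw : 0 ≤ w.im) : 0 ≤ (w ^ (1 / 2 : ℂ)).im := by
  rw [im_cpow_half]
  refine mul_nonneg (Real.rpow_nonneg (norm_nonneg _) _) (Real.sin_nonneg_of_mem_Icc ?_)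
  have := Complex.arg_nonneg_iff.2 hw
  constructor <;> linarith [Real.pi_pos, Complex.arg_le_pi w]

theorem im_cpow_half_nonpos {w : ℂ} (hw : w.im < 0) : (w ^ (1 / 2 : ℂ)).im ≤ 0 := by
  rw [im_cpow_half]
  have := Complex.arg_neg_iff.2 hw
  refine mul_nonpos_of_nonneg_of_nonpos (Real.rpow_nonneg (norm_nonneg _) _)
    (Real.sin_nonpos_of_nonpos_of_neg_pi_le ?_ ?_) <;>
  linarith [Complex.neg_pi_lt_arg w, Real.pi_pos]

/-- With u, v the principal roots of z - 1, z + 1 one has ζ = (u - v)²/2 and ζ⁻¹ = (u + v)²/2. Both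
roots have nonnegative real part and imaginary parts of the same sign, so Re(u v̄) ≥ 0 and |u - v| ≤
|u + v|. -/
theorem norm_zetaFn_le_one (z : ℂ) : ‖zetaFn z‖ ≤ 1 := by
  set u := (z - 1) ^ (1 / 2 : ℂ) with hu
  set v := (z + 1) ^ (1 / 2 : ℂ) with hv
  have hu2 : u ^ 2 = z - 1 := cpow_half_sq _
  have hv2 : v ^ 2 = z + 1 := cpow_half_sq _
  have hζ : zetaFn z = (u - v) ^ 2 / 2 := by
    rw [zetaFn, sqrtZ, ← hu, ← hv]
    linear_combination -(hu2 + hv2) / 2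
  have hprod : zetaFn z * ((u + v) ^ 2 / 2) = 1 := by
    rw [hζ]
    have : (u - v) ^ 2 / 2 * ((u + v) ^ 2 / 2) = (u ^ 2 - v ^ 2) ^ 2 / 4 := by ring
    rw [this, hu2, hv2]
    ring
  have him : 0 ≤ u.im * v.im := by
    rcases le_or_gt 0 z.im with h | h
    · exact mul_nonneg (im_cpow_half_nonneg (by simpa using h))
        (im_cpow_half_nonneg (by simpa using h))
    · exact mul_nonneg_of_nonpos_of_nonpos (im_cpow_half_nonpos (by simpa using h))
        (im_cpow_half_nonpos (by simpa using h))
  have hre : 0 ≤ u.re * v.re := mul_nonneg (re_cpow_half_nonneg _) (re_cpow_half_nonneg _)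
  have hle : ‖u - v‖ ^ 2 ≤ ‖u + v‖ ^ 2 := by
    rw [← Complex.normSq_eq_norm_sq, ← Complex.normSq_eq_norm_sq, Complex.normSq_apply,
      Complex.normSq_apply]
    simp only [Complex.sub_re, Complex.sub_im, Complex.add_re, Complex.add_im]
    nlinarith
  have h1 : ‖zetaFn z‖ ≤ ‖(u + v) ^ 2 / 2‖ := by
    rw [hζ, norm_div, norm_div, norm_pow, norm_pow]
    gcongr
  have h2 : ‖zetaFn z‖ * ‖(u + v) ^ 2 / 2‖ = 1 := by rw [← norm_mul, hprod, norm_one]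
  nlinarith [norm_nonneg (zetaFn z)]

/-- On the unit circle ζ⁻¹ = ζ̄, so z = Re ζ would lie in [-1, 1]. -/
theorem norm_zetaFn_lt_one {z : ℂ} (hz : z ∈ cutPlane) : ‖zetaFn z‖ < 1 := by
  refine lt_of_le_of_ne (norm_zetaFn_le_one z) fun h => hz ?_
  refine ⟨(zetaFn z).re, ?_, ?_⟩
  · have := Complex.abs_re_le_norm (zetaFn z)
    rw [h] at this
    exact abs_le.1 this
  · have h1 : zetaFn z * (starRingEnd ℂ) (zetaFn z) = 1 := by
      rw [Complex.mul_conj, Complex.normSq_eq_norm_sq, h]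
      norm_num
    have h2 : 2 * z = zetaFn z + (starRingEnd ℂ) (zetaFn z) := by
      apply mul_right_cancel₀ (zetaFn_ne_zero z)
      linear_combination two_mul_zetaFn z - h1
    rw [Complex.add_conj] at h2
    push_cast at h2
    exact (mul_left_cancel₀ two_ne_zero h2).symm

theorem sq_ne_one_of_mem_cutPlane {z : ℂ} (hz : z ∈ cutPlane) : z ^ 2 ≠ 1 := by
  intro h
  rcases sq_eq_sq_iff_eq_or_eq_neg.1 (h.trans (one_pow 2).symm) with rfl | rfl
  · exact hz ⟨1, by norm_num, by norm_num⟩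
  · exact hz ⟨-1, by norm_num, by norm_num⟩

/-- The open upper half-plane together with the interval `(-1, 1)`. -/
def upperRegion : Set ℂ := {z | 0 < z.im ∨ z.im = 0 ∧ z.re ∈ Ioo (-1 : ℝ) 1}

theorem im_nonneg_of_mem_upperRegion {z : ℂ} (hz : z ∈ upperRegion) : 0 ≤ z.im := by
  rcases hz with h | h
  · exact h.le
  · exact h.1.ge

theorem sq_ne_one_of_mem_upperRegion {z : ℂ} (hz : z ∈ upperRegion) : z ^ 2 ≠ 1 := by
  intro h
  rcases sq_eq_sq_iff_eq_or_eq_neg.1 (h.trans (one_pow 2).symm) with rfl | rfl <;>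
  simp [upperRegion] at hz

theorem ofReal_mem_upperRegion {t : ℝ} (ht : t ∈ Ioo (-1 : ℝ) 1) : (t : ℂ) ∈ upperRegion :=
  Or.inr ⟨Complex.ofReal_im t, by simpa using ht⟩

theorem mem_cutPlane_of_im_pos {z : ℂ} (hz : 0 < z.im) : z ∈ cutPlane := by
  rintro ⟨t, -, rfl⟩
  simp at hz

/-- On (-1, 1) the number z - 1 lies on the branch cut of the logarithm, but the principal branch is
continuous from the closed upper half-plane. -/
theorem continuousOn_zetaFn : ContinuousOn zetaFn upperRegion := by
  have h1 : ∀ z ∈ upperRegion, z - 1 ≠ 0 := fun z hz h =>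
    sq_ne_one_of_mem_upperRegion hz (by rw [sub_eq_zero.1 h, one_pow])
  have h2 : ∀ z ∈ upperRegion, z + 1 ≠ 0 := fun z hz h =>
    sq_ne_one_of_mem_upperRegion hz (by rw [eq_neg_of_add_eq_zero_left h]; norm_num)
  have hlog1 : ContinuousOn (fun z : ℂ => Complex.log (z - 1)) upperRegion := by
    intro z hz
    have hmap : MapsTo (fun z : ℂ => z - 1) upperRegion {w | 0 ≤ w.im} := fun w hw => by
      simpa using im_nonneg_of_mem_upperRegion hw
    have hsub : ContinuousWithinAt (fun z : ℂ => z - 1) upperRegion z :=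
      (continuous_id.sub continuous_const).continuousWithinAt
    refine ContinuousWithinAt.comp (f := fun z : ℂ => z - 1) (g := Complex.log)
      (t := {w | 0 ≤ w.im}) ?_ hsub hmap
    rcases hz with h | h
    · exact (continuousAt_clog (Or.inr (by simpa using h.ne'))).continuousWithinAt
    · exact Complex.continuousWithinAt_log_of_re_neg_of_im_zero
        (by simpa using h.2.2) (by simpa using h.1)
  have hlog2 : ContinuousOn (fun z : ℂ => Complex.log (z + 1)) upperRegion := by
    refine ContinuousOn.clog (by fun_prop) fun z hz => ?_
    rcases hz with h | h
    · exact Or.inr (by simpa using h.ne')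
    · refine Or.inl ?_
      have := h.2.1
      simp
      linarith
  have h3 : ContinuousOn (fun z : ℂ => z - Complex.exp (Complex.log (z - 1) * (1 / 2))
      * Complex.exp (Complex.log (z + 1) * (1 / 2))) upperRegion := by fun_prop
  refine h3.congr fun z hz => ?_
  rw [zetaFn, sqrtZ, Complex.cpow_def_of_ne_zero (h1 z hz), Complex.cpow_def_of_ne_zero (h2 z hz)]

theorem zetaFn_ofReal {t : ℝ} (ht : t ∈ Ioo (-1 : ℝ) 1) :
    zetaFn t = t - √(1 - t ^ 2) * Complex.I := by
  have h1 : ((t : ℂ) - 1) ^ (1 / 2 : ℂ) = √(1 - t) * Complex.I := by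
    have h := Complex.ofReal_cpow_of_nonpos (x := t - 1) (by linarith [ht.2]) (1 / 2 : ℂ)
    rw [Complex.ofReal_sub, Complex.ofReal_one] at h
    have e1 : Complex.exp (Real.pi * Complex.I * (1 / 2)) = Complex.I := by
      rw [show (Real.pi : ℂ) * Complex.I * (1 / 2) = Real.pi / 2 * Complex.I by ring,
        Complex.exp_pi_div_two_mul_I]
    have e2 : (-((t : ℂ) - 1)) ^ (1 / 2 : ℂ) = (√(1 - t) : ℝ) := by
      rw [Real.sqrt_eq_rpow, Complex.ofReal_cpow (by linarith [ht.2])]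
      push_cast
      ring_nf
    rw [h, e1, e2]
  have h2 : ((t : ℂ) + 1) ^ (1 / 2 : ℂ) = √(1 + t) := by
    rw [Real.sqrt_eq_rpow, Complex.ofReal_cpow (by linarith [ht.1])]
    push_cast
    ring_nf
  have h3 : √(1 - t ^ 2) = √(1 - t) * √(1 + t) := by
    rw [← Real.sqrt_mul (by linarith [ht.2])]
    congr 1
    ring
  rw [zetaFn, sqrtZ, h1, h2, h3]
  push_cast
  ring

theorem one_sub_sq_pos {t : ℝ} (ht : t ∈ Ioo (-1 : ℝ) 1) : 0 < 1 - t ^ 2 := by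
  nlinarith [ht.1, ht.2]

theorem zetaFn_mul_conj_ofReal {t : ℝ} (ht : t ∈ Ioo (-1 : ℝ) 1) :
    zetaFn t * (starRingEnd ℂ) (zetaFn t) = 1 := by
  have h : ((√(1 - t ^ 2) : ℝ) : ℂ) ^ 2 = 1 - t ^ 2 := by
    rw [← Complex.ofReal_pow, Real.sq_sqrt (one_sub_sq_pos ht).le]
    push_cast
    rfl
  rw [zetaFn_ofReal ht]
  simp only [map_sub, map_mul, Complex.conj_ofReal, Complex.conj_I]
  linear_combination h - (√(1 - t ^ 2) : ℂ) ^ 2 * Complex.I_sq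

theorem norm_zetaFn_ofReal {t : ℝ} (ht : t ∈ Ioo (-1 : ℝ) 1) : ‖zetaFn t‖ = 1 := by
  have h := congrArg norm (zetaFn_mul_conj_ofReal ht)
  rw [norm_mul, RCLike.norm_conj, norm_one] at h
  nlinarith [norm_nonneg (zetaFn t)]

end ZetaFunction

/-! ### Wronskians and uniqueness of the Jost solution -/

section Wronskians

variable {a b : ℕ → ℝ} {z : ℂ} {u v : ℕ → ℂ}

theorem SolvesJacobi.wronskian_eq (hu : SolvesJacobi a b z u) (hv : SolvesJacobi a b z v) (n : ℕ) :
    wronskian a u v = prevCoeff a n * (u n * v (n + 1) - u (n + 1) * v n) := by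
  induction n with
  | zero => rfl
  | succ n ih =>
    rw [ih]
    have h1 := hu n
    have h2 := hv n
    rw [show prevCoeff a (n + 1) = a n from rfl]
    linear_combination v (n + 1) * h1 - u (n + 1) * h2

theorem SolvesJacobi.sub_smul (hu : SolvesJacobi a b z u) (hv : SolvesJacobi a b z v) (c : ℂ) :
    SolvesJacobi a b z (fun n => u n - c * v n) := fun n => by
  linear_combination hu n - c * hv n

theorem SolvesJacobi.eq_zero (ha : ∀ n, 0 < a n) (hu : SolvesJacobi a b z u) {N : ℕ}
    (h0 : u N = 0) (h1 : u (N + 1) = 0) (n : ℕ) : u n = 0 := by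
  have hp : ∀ n, (prevCoeff a n : ℂ) ≠ 0 := fun n => by exact_mod_cast (prevCoeff_pos ha n).ne'
  have hback : ∀ N, u N = 0 → u (N + 1) = 0 → u 0 = 0 ∧ u 1 = 0 := by
    intro N
    induction N with
    | zero => exact fun h0 h1 => ⟨h0, h1⟩
    | succ N ih =>
      intro h0 h1
      refine ih ?_ h0
      have h := hu N
      rw [h0, h1] at h
      simpa [hp N] using h
  have hforw : ∀ n, u n = 0 ∧ u (n + 1) = 0 := by
    intro n
    induction n with
    | zero => exact hback N h0 h1
    | succ n ih =>
      refine ⟨ih.2, ?_⟩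
      have h := hu n
      rw [ih.1, ih.2] at h
      simpa [(ha n).ne'] using h
  exact (hforw n).1

theorem SolvesJacobi.eq_smul_of_wronskian_eq_zero (ha : ∀ n, 0 < a n) (hu : SolvesJacobi a b z u)
    (hv : SolvesJacobi a b z v) (h : wronskian a u v = 0) {N : ℕ} (hN : v N ≠ 0) (n : ℕ) :
    u n = u N / v N * v n := by
  have hw := hu.sub_smul hv (u N / v N)
  have hp : (prevCoeff a N : ℂ) ≠ 0 := by exact_mod_cast (prevCoeff_pos ha N).ne'
  have h1 := hu.wronskian_eq hv N
  rw [h] at h1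
  have h2 : u N * v (N + 1) - u (N + 1) * v N = 0 := by
    simpa [hp] using h1.symm
  refine sub_eq_zero.1 (hw.eq_zero ha (N := N) ?_ ?_ n)
  · field_simp
    ring
  · field_simp
    linear_combination -h2

theorem coeffTail_nonneg (n : ℕ) : 0 ≤ coeffTail a b n :=
  tsum_nonneg fun _ => by positivity

theorem isJostSolution_jostSeq (hab : Summable fun n => |a n - 1 / 2| + |b n|)
    (ha : ∀ n, 0 < a n) (hz : z ∈ cutPlane) : IsJostSolution a b z (jostSeq a b (zetaFn z)) := by
  obtain ⟨δ, hδ, hmem⟩ := mem_jostRegion (zetaFn_ne_zero z) (norm_zetaFn_le_one z)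
    (zetaFn_sq_ne_one (sq_ne_one_of_mem_cutPlane hz))
  refine ⟨solvesJacobi_jostSeq hab ha hδ hmem (two_mul_zetaFn z), ?_⟩
  obtain ⟨K, hK⟩ := exists_norm_jostRatio_sub_one_le hab ha hδ hmem
  refine Asymptotics.IsBigO.of_bound K (Eventually.of_forall fun n => ?_)
  have h0 := zetaFn_ne_zero z
  have h1 : jostSeq a b (zetaFn z) (n + 1) / zetaFn z ^ n = jostRatio a b (zetaFn z) (n + 1) := by
    rw [jostSeq, pow_succ]
    field_simp
  rw [h1, Real.norm_of_nonneg (coeffTail_nonneg n)]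
  exact hK n

theorem IsJostSolution.tendsto {f : ℕ → ℂ} (hf : IsJostSolution a b z f) :
    Tendsto (fun n => f (n + 1) / zetaFn z ^ n) atTop (𝓝 1) := by
  have h := hf.2.trans_tendsto tendsto_coeffTail
  simpa using h.add_const 1

theorem tendsto_ofReal_coeff (hab : Summable fun n => |a n - 1 / 2| + |b n|) :
    Tendsto (fun n => (a n : ℂ)) atTop (𝓝 (1 / 2)) := by
  have h : Tendsto a atTop (𝓝 (1 / 2)) := by
    rw [tendsto_iff_norm_sub_tendsto_zero]
    exact squeeze_zero (fun n => norm_nonneg _)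
      (fun n => by rw [Real.norm_eq_abs]; linarith [abs_nonneg (b n)]) hab.tendsto_atTop_zero
  have h2 := (Complex.continuous_ofReal.tendsto _).comp h
  push_cast at h2
  exact h2

/-- Both solutions decay because |ζ| < 1, so their constant Wronskian is zero and they are
proportional; the normalisation at infinity makes the factor 1. -/
theorem IsJostSolution.unique (ha : ∀ n, 0 < a n) (hab : Summable fun n => |a n - 1 / 2| + |b n|)
    (hz : z ∈ cutPlane) {f g : ℕ → ℂ} (hf : IsJostSolution a b z f)
    (hg : IsJostSolution a b z g) : f = g := by
  have h0 := zetaFn_ne_zero z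
  have hW : wronskian a f g = 0 := by
    have hat := tendsto_ofReal_coeff hab
    have hpow : Tendsto (fun n => zetaFn z ^ n) atTop (𝓝 0) :=
      tendsto_pow_atTop_nhds_zero_of_norm_lt_one (norm_zetaFn_lt_one hz)
    have hF : ∀ {f : ℕ → ℂ}, IsJostSolution a b z f →
        Tendsto (fun n => f (n + 1)) atTop (𝓝 0) := by
      intro f hf
      have := hf.tendsto.mul hpow
      rw [mul_zero] at this
      refine this.congr fun n => ?_
      field_simp
    have h1 : ∀ {f : ℕ → ℂ}, IsJostSolution a b z f →
        Tendsto (fun n => f (n + 1 + 1)) atTop (𝓝 0) := fun hf =>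
      (tendsto_add_atTop_iff_nat (f := fun n => _) 1).2 (hF hf)
    have h2 := hat.mul (((hF hf).mul (h1 hg)).sub ((h1 hf).mul (hF hg)))
    have h3 : ∀ n, (a n : ℂ) * (f (n + 1) * g (n + 1 + 1) - f (n + 1 + 1) * g (n + 1))
        = wronskian a f g := fun n => (hf.1.wronskian_eq hg.1 (n + 1)).symm
    simp only [h3] at h2
    simpa using tendsto_nhds_unique tendsto_const_nhds h2
  obtain ⟨N, hN⟩ := (hg.tendsto.eventually_ne one_ne_zero).exists
  have hN' : g (N + 1) ≠ 0 := fun h => hN (by rw [h, zero_div])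
  have hfg := hf.1.eq_smul_of_wronskian_eq_zero ha hg.1 hW hN'
  set c := f (N + 1) / g (N + 1)
  have h1 := hg.tendsto.const_mul c
  have hc : c = 1 := by
    have h2 := tendsto_nhds_unique (h1.congr fun n => by rw [hfg (n + 1), mul_div_assoc]) hf.tendsto
    simpa using h2
  funext n
  rw [hfg n, hc, one_mul]

theorem existsUnique_isJostSolution (ha : ∀ n, 0 < a n)
    (hab : Summable fun n => |a n - 1 / 2| + |b n|) (hz : z ∈ cutPlane) :
    ∃! f : ℕ → ℂ, IsJostSolution a b z f :=
  ⟨_, isJostSolution_jostSeq hab ha hz, fun _ hf => hf.unique ha hab hz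
    (isJostSolution_jostSeq hab ha hz)⟩

theorem jostSolution_eq (ha : ∀ n, 0 < a n)
    (hab : Summable fun n => |a n - 1 / 2| + |b n|) (hz : z ∈ cutPlane) :
    jostSolution a b z = jostSeq a b (zetaFn z) :=
  IsJostSolution.unique ha hab hz
    (Classical.epsilon_spec (p := IsJostSolution a b z) ⟨_, isJostSolution_jostSeq hab ha hz⟩)
    (isJostSolution_jostSeq hab ha hz)

end Wronskians

/-! ### The Jacobi operator in ℓ² -/

section JacobiOperator

variable {a b : ℕ → ℝ}

theorem exists_bound_of_summable (hab : Summable fun n => |a n - 1 / 2| + |b n|) :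
    ∃ C, ∀ n, |a n| ≤ C ∧ |b n| ≤ C := by
  refine ⟨(∑' n, (|a n - 1 / 2| + |b n|)) + 1 / 2, fun n => ?_⟩
  have h1 := hab.le_tsum n fun _ _ => by positivity
  have h2 : |a n| ≤ |a n - 1 / 2| + 1 / 2 := by
    have := abs_add_le (a n - 1 / 2) (1 / 2)
    rwa [sub_add_cancel, abs_of_pos (by norm_num : (0 : ℝ) < 1 / 2)] at this
  constructor <;> linarith [abs_nonneg (b n), abs_nonneg (a n - 1 / 2)]

theorem inner_basisVec_left (m : ℕ) (u : EllTwo) : inner ℂ (basisVec m) u = u m := by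
  simp [basisVec, lp.inner_single_left]

theorem basisVec_apply (n m : ℕ) : basisVec n m = if m = n then 1 else 0 := by
  simp [basisVec, Pi.single_apply]

/-- The value of `w` at 0 stands for index -1. Its vanishing is the boundary condition under which
the operator acts as the difference expression. -/
theorem jacobiOperator_apply_of_shift (h : ∃ C, ∀ n, |a n| ≤ C ∧ |b n| ≤ C) {u : EllTwo}
    {w : ℕ → ℂ} (h0 : w 0 = 0) (hw : ∀ m, u m = w (m + 1)) (m : ℕ) :
    jacobiOperator a b u m = prevCoeff a m * w m + b m * w (m + 1) + a m * w (m + 2) := by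
  rw [jacobiOperator_apply a b h]
  cases m with
  | zero => simp [h0, hw]
  | succ m => simp [hw, prevCoeff]

theorem jacobiOperator_basisVec (h : ∃ C, ∀ n, |a n| ≤ C ∧ |b n| ≤ C) (m : ℕ) :
    jacobiOperator a b (basisVec m) = (if m = 0 then 0 else (a (m - 1) : ℂ)) • basisVec (m - 1)
      + (b m : ℂ) • basisVec m + (a m : ℂ) • basisVec (m + 1) := by
  ext k
  rw [jacobiOperator_apply a b h]
  simp only [lp.coeFn_add, lp.coeFn_smul, Pi.add_apply, Pi.smul_apply, basisVec_apply, smul_eq_mul]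
  rcases Nat.lt_trichotomy k m with hk | rfl | hk
  · by_cases h1 : k + 1 = m
    · subst h1
      have h2 : k ≠ k + 1 + 1 := by omega
      simp [h2]
    · have h2 : k - 1 ≠ m := by omega
      have h3 : k ≠ m := by omega
      have h4 : k ≠ m - 1 := by omega
      have h5 : k ≠ m + 1 := by omega
      simp [h1, h2, h3, h4, h5]
  · rcases Nat.eq_zero_or_pos k with rfl | hk
    · simp
    · have h2 : k - 1 ≠ k := by omega
      have h4 : k ≠ k - 1 := by omega
      simp [h2, h4]
  · by_cases h1 : k = m + 1
    · subst h1
      have h2 : m + 1 ≠ m - 1 := by omega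
      have h3 : m + 1 + 1 ≠ m := by omega
      simp [h2, h3]
    · have h2 : k - 1 ≠ m := by omega
      have h3 : k ≠ m := by omega
      have h4 : k ≠ m - 1 := by omega
      have h5 : k + 1 ≠ m := by omega
      simp [h1, h2, h3, h4, h5]

theorem isSelfAdjoint_jacobiOperator (h : ∃ C, ∀ n, |a n| ≤ C ∧ |b n| ≤ C) :
    IsSelfAdjoint (jacobiOperator a b) := by
  rw [ContinuousLinearMap.isSelfAdjoint_iff']
  ext u m
  rw [← inner_basisVec_left, ContinuousLinearMap.adjoint_inner_right, jacobiOperator_basisVec h,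
    jacobiOperator_apply a b h]
  simp only [inner_add_left, inner_smul_left, inner_basisVec_left, Complex.conj_ofReal]
  split_ifs <;> simp

theorem span_basisVec_dense :
    (Submodule.span ℂ (range basisVec)).topologicalClosure = ⊤ := by
  rw [Submodule.topologicalClosure_eq_top_iff, Submodule.eq_bot_iff]
  intro x hx
  ext m
  rw [← inner_basisVec_left]
  exact hx _ (Submodule.subset_span ⟨m, rfl⟩)

theorem star_basisVec (n : ℕ) : star (basisVec n) = basisVec n := by
  ext m
  rw [lp.star_apply, basisVec_apply]
  split_ifs <;> simp

theorem jacobiOperator_star (h : ∃ C, ∀ n, |a n| ≤ C ∧ |b n| ≤ C) (u : EllTwo) :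
    jacobiOperator a b (star u) = star (jacobiOperator a b u) := by
  ext m
  rw [lp.star_apply, jacobiOperator_apply a b h, jacobiOperator_apply a b h]
  simp only [lp.star_apply, star_add]
  split_ifs <;> simp

theorem memℓp_two_of_isBigO_pow {f : ℕ → ℂ} {r : ℝ} (h0 : 0 ≤ r) (h1 : r < 1)
    (hf : f =O[atTop] fun n => r ^ n) : Memℓp f 2 := by
  refine memℓp_gen ?_
  have h2 : (fun n => ‖f n‖ ^ 2) =O[atTop] fun n => (r ^ 2) ^ n :=
    (hf.norm_left.pow 2).congr_right fun n => by ring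
  have h3 := summable_of_isBigO_nat
    (summable_geometric_of_lt_one (sq_nonneg r) (by nlinarith)) h2
  simpa using h3

theorem jacobiOperator_eq_smul_im_eq_zero (h : ∃ C, ∀ n, |a n| ≤ C ∧ |b n| ≤ C) {z : ℂ}
    (hz : z.im ≠ 0) {u : EllTwo} (hu : jacobiOperator a b u = z • u) : u = 0 := by
  have hs := (ContinuousLinearMap.isSelfAdjoint_iff_isSymmetric.1
    (isSelfAdjoint_jacobiOperator h)) u u
  change inner ℂ (jacobiOperator a b u) u = inner ℂ u (jacobiOperator a b u) at hs
  rw [hu, inner_smul_left, inner_smul_right] at hs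
  by_contra hne
  have h1 : inner ℂ u u ≠ 0 := inner_self_ne_zero.2 hne
  exact hz (Complex.conj_eq_iff_im.1 (mul_right_cancel₀ h1 hs))

end JacobiOperator

/-! ### The Poisson kernel as imaginary part of the resolvent -/

section Poisson

variable {E : Type*} [NormedAddCommGroup E] [InnerProductSpace ℂ E] [CompleteSpace E]

theorem algebraMap_real_apply {F : Type*} [NormedAddCommGroup F] [InnerProductSpace ℂ F]
    (r : ℝ) (x : F) : algebraMap ℝ (F →L[ℂ] F) r x = (r : ℂ) • x := by
  rw [Algebra.algebraMap_eq_smul_one]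
  simp

/-- The Poisson kernel of a self-adjoint operator is the imaginary part of its resolvent. -/
theorem poissonOp_apply {T : E →L[ℂ] E} (hT : IsSelfAdjoint T) {l ε : ℝ} (hε : 0 < ε)
    {v v' y : E} (hv : T v - (l + ε * Complex.I : ℂ) • v = y)
    (hv' : T v' - (l - ε * Complex.I : ℂ) • v' = y) :
    poissonOp T ε l y = (1 / (2 * Complex.I)) • (v - v') := by
  have hD : ∀ x, cfc (fun s : ℝ => s - l) T x = T x - (l : ℂ) • x := by
    intro x
    rw [cfc_sub (fun s : ℝ => s) (fun _ => l) T (by fun_prop) (by fun_prop), cfc_id' ℝ T,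
      cfc_const l T, sub_apply, algebraMap_real_apply]
  have hq : ∀ x, cfc (fun s : ℝ => (s - l) * (s - l) + ε ^ 2) T x
      = cfc (fun s : ℝ => s - l) T (cfc (fun s : ℝ => s - l) T x) + ((ε ^ 2 : ℝ) : ℂ) • x := by
    intro x
    rw [cfc_add_const (ε ^ 2) (fun s : ℝ => (s - l) * (s - l)) T (by fun_prop),
      cfc_mul _ _ T (by fun_prop) (by fun_prop), add_apply, algebraMap_real_apply,
      mul_apply_eq_comp]
  have hpq : ∀ x, cfc (poissonKer ε l) T (cfc (fun s : ℝ => (s - l) * (s - l) + ε ^ 2) T x)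
      = (ε : ℂ) • x := by
    intro x
    have hc := continuous_poissonKer_right hε l
    rw [← mul_apply_eq_comp, ← cfc_mul _ _ T (by fun_prop) (by fun_prop)]
    have : (fun s => poissonKer ε l s * ((s - l) * (s - l) + ε ^ 2)) = fun _ => ε := by
      funext s
      have := (poissonKer_denom_pos hε l s).ne'
      rw [poissonKer, ← sq, div_mul_cancel₀ _ this]
    rw [this, cfc_const ε T, algebraMap_real_apply]
  have e1 : cfc (fun s : ℝ => s - l) T v = y + (ε * Complex.I : ℂ) • v := by
    rw [hD, ← hv]
    module
  have e2 : cfc (fun s : ℝ => s - l) T v' = y - (ε * Complex.I : ℂ) • v' := by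
    rw [hD, ← hv']
    module
  -- Applying T - l twice to v - v' gives 2iεy - ε²(v - v'). The quadratic polynomial is then
  -- cancelled against the Poisson kernel, so no inverse operator is needed.
  have e3 : cfc (fun s : ℝ => (s - l) * (s - l) + ε ^ 2) T (v - v')
      = (2 * ε * Complex.I : ℂ) • y := by
    rw [hq, map_sub, e1, e2, map_sub, map_add, map_sub, map_smul, map_smul, e1, e2]
    have hI : (ε * Complex.I : ℂ) * (ε * Complex.I) = -((ε ^ 2 : ℝ) : ℂ) := by
      push_cast
      linear_combination (ε : ℂ) ^ 2 * Complex.I_sq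
    simp only [smul_add, smul_sub, smul_smul, hI]
    module
  unfold poissonOp
  have e4 := hpq (v - v')
  rw [e3, map_smul] at e4
  have hε' : (ε : ℂ) ≠ 0 := by exact_mod_cast hε.ne'
  have hne : (2 * ε * Complex.I : ℂ) ≠ 0 := by simp [hε']
  apply smul_right_injective E hne
  change (2 * ε * Complex.I : ℂ) • _ = (2 * ε * Complex.I : ℂ) • _
  rw [e4, smul_smul]
  congr 1
  field_simp

end Poisson

/-! ### The Green function -/

section GreenFunction

variable (a b : ℕ → ℝ)

/-- The Wronskian of the polynomial and the Jost solutions, in terms of `ζ(z)`; unlike `omegaFn`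
it is also meaningful on the cut. -/
def omegaExt (z : ℂ) : ℂ := wronskian a (polySolution a b z) (jostSeq a b (zetaFn z))

/-- The `n`-th column of the resolvent matrix (row index shifted by one). -/
def greenSeq (z : ℂ) (n k : ℕ) : ℂ :=
  polySolution a b z (min k (n + 1)) * jostSeq a b (zetaFn z) (max k (n + 1)) / omegaExt a b z

variable {a b} {z : ℂ}

theorem polySolution_zero : polySolution a b z 0 = 0 := by simp [polySolution, orthoPolyAux]

theorem polySolution_one : polySolution a b z 1 = 1 := by simp [polySolution, orthoPolyAux]

theorem polySolution_succ_ofReal (n : ℕ) (t : ℝ) :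
    polySolution a b t (n + 1) = ((orthoPoly a b n).eval t : ℝ) := by
  rw [polySolution, orthoPoly, ← Complex.coe_algebraMap, aeval_algebraMap_apply]
  simp

theorem conj_polySolution_ofReal (k : ℕ) (t : ℝ) :
    (starRingEnd ℂ) (polySolution a b t k) = polySolution a b t k := by
  cases k with
  | zero => simp [polySolution_zero]
  | succ k => rw [polySolution_succ_ofReal, Complex.conj_ofReal]

theorem omegaExt_eq : omegaExt a b z = -(1 / 2) * jostSeq a b (zetaFn z) 0 := by
  rw [omegaExt, _root_.wronskian, polySolution_zero, polySolution_one, prevCoeff]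
  push_cast
  ring

theorem jostSeq_isBigO (hab : Summable fun n => |a n - 1 / 2| + |b n|)
    (ha : ∀ n, 0 < a n) (hz : z ^ 2 ≠ 1) :
    (fun n => jostSeq a b (zetaFn z) (n + 1)) =O[atTop] fun n => ‖zetaFn z‖ ^ n := by
  obtain ⟨δ, hδ, hmem⟩ := mem_jostRegion (zetaFn_ne_zero z) (norm_zetaFn_le_one z)
    (zetaFn_sq_ne_one hz)
  have h1 : (fun n => jostRatio a b (zetaFn z) (n + 1)) =O[atTop] fun _ => (1 : ℝ) :=
    ((tendsto_add_atTop_iff_nat 1).2 (tendsto_jostRatio hab ha hδ hmem)).isBigO_one ℝ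
  have h2 : (fun n => zetaFn z ^ n) =O[atTop] fun n => ‖zetaFn z‖ ^ n :=
    Asymptotics.isBigO_of_le _ fun n => by simp
  refine (h2.mul h1).congr (fun n => ?_) fun n => mul_one _
  rw [jostSeq, pow_succ]
  have := zetaFn_ne_zero z
  field_simp

theorem exists_jostSeq_ne_zero (hab : Summable fun n => |a n - 1 / 2| + |b n|)
    (ha : ∀ n, 0 < a n) (hz : z ^ 2 ≠ 1) : ∃ n, jostSeq a b (zetaFn z) (n + 1) ≠ 0 := by
  obtain ⟨δ, hδ, hmem⟩ := mem_jostRegion (zetaFn_ne_zero z) (norm_zetaFn_le_one z)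
    (zetaFn_sq_ne_one hz)
  obtain ⟨n, hn⟩ := (((tendsto_add_atTop_iff_nat 1).2
    (tendsto_jostRatio hab ha hδ hmem)).eventually_ne one_ne_zero).exists
  exact ⟨n, by simp [jostSeq, zetaFn_ne_zero z, hn]⟩

theorem solvesJacobi_jostSeq_zetaFn (hab : Summable fun n => |a n - 1 / 2| + |b n|)
    (ha : ∀ n, 0 < a n) (hz : z ^ 2 ≠ 1) : SolvesJacobi a b z (jostSeq a b (zetaFn z)) := by
  obtain ⟨δ, hδ, hmem⟩ := mem_jostRegion (zetaFn_ne_zero z) (norm_zetaFn_le_one z)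
    (zetaFn_sq_ne_one hz)
  exact solvesJacobi_jostSeq hab ha hδ hmem (two_mul_zetaFn z)

theorem sq_ne_one_of_im_pos (hz : 0 < z.im) : z ^ 2 ≠ 1 :=
  sq_ne_one_of_mem_cutPlane (mem_cutPlane_of_im_pos hz)

/-- A zero means f_{-1} = 0, so the decaying solution is an eigenvector of a self-adjoint operator
with non-real eigenvalue. -/
theorem omegaExt_ne_zero_of_im_pos (hab : Summable fun n => |a n - 1 / 2| + |b n|)
    (ha : ∀ n, 0 < a n) (hz : 0 < z.im) : omegaExt a b z ≠ 0 := by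
  intro h
  have h0 : jostSeq a b (zetaFn z) 0 = 0 := by
    rw [omegaExt_eq] at h
    simpa using h
  have hb := exists_bound_of_summable hab
  have hmem : Memℓp (fun n => jostSeq a b (zetaFn z) (n + 1)) 2 :=
    memℓp_two_of_isBigO_pow (norm_nonneg _)
      (norm_zetaFn_lt_one (mem_cutPlane_of_im_pos hz))
      (jostSeq_isBigO hab ha (sq_ne_one_of_im_pos hz))
  let u : EllTwo := ⟨_, hmem⟩
  have hu : ∀ m, u m = jostSeq a b (zetaFn z) (m + 1) := fun m => rfl
  have hHu : jacobiOperator a b u = z • u := by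
    ext m
    rw [jacobiOperator_apply_of_shift hb h0 hu,
      solvesJacobi_jostSeq_zetaFn hab ha (sq_ne_one_of_im_pos hz) m]
    rfl
  have hu0 := jacobiOperator_eq_smul_im_eq_zero hb hz.ne' hHu
  obtain ⟨n, hn⟩ := exists_jostSeq_ne_zero hab ha (sq_ne_one_of_im_pos hz)
  apply hn
  rw [← hu, hu0]
  rfl

theorem greenSeq_zero (n : ℕ) : greenSeq a b z n 0 = 0 := by
  simp [greenSeq, polySolution_zero]

/-- Off the diagonal only one of the two solutions varies with the row, so its equation applies. On
the diagonal the mismatch between them is exactly the Wronskian, which the denominator normalises to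
1. -/
theorem greenSeq_equation (hab : Summable fun n => |a n - 1 / 2| + |b n|)
    (ha : ∀ n, 0 < a n) (hz : z ^ 2 ≠ 1) (hω : omegaExt a b z ≠ 0) (n m : ℕ) :
    prevCoeff a m * greenSeq a b z n m + b m * greenSeq a b z n (m + 1)
      + a m * greenSeq a b z n (m + 2) - z * greenSeq a b z n (m + 1)
      = if m = n then 1 else 0 := by
  have hP := solvesJacobi_polySolution a b ha z
  have hf := solvesJacobi_jostSeq_zetaFn hab ha hz
  have hW : omegaExt a b z = _ := hP.wronskian_eq hf n
  simp only [greenSeq]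
  rcases Nat.lt_trichotomy m n with h | rfl | h
  · rw [if_neg h.ne, min_eq_left (by omega), min_eq_left (by omega), min_eq_left (by omega),
      max_eq_right (by omega), max_eq_right (by omega), max_eq_right (by omega)]
    linear_combination (jostSeq a b (zetaFn z) (n + 1) / omegaExt a b z) * hP m
  · rw [if_pos rfl, min_eq_left (by omega), min_self, min_eq_right (by omega),
      max_eq_right (by omega), max_self, max_eq_left (by omega)]
    have h1 := hf m
    field_simp
    rw [hW]
    linear_combination polySolution a b z (m + 1) * h1
  · rw [if_neg h.ne', min_eq_right (by omega), min_eq_right (by omega), min_eq_right (by omega),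
      max_eq_left (by omega), max_eq_left (by omega), max_eq_left (by omega)]
    linear_combination (polySolution a b z (n + 1) / omegaExt a b z) * hf m

theorem exists_resolvent_column (hab : Summable fun n => |a n - 1 / 2| + |b n|)
    (ha : ∀ n, 0 < a n) (hz : 0 < z.im) (n : ℕ) :
    ∃ v : EllTwo, (∀ m, v m = greenSeq a b z n (m + 1)) ∧
      jacobiOperator a b v - z • v = basisVec n := by
  have hmem : Memℓp (fun m => greenSeq a b z n (m + 1)) 2 := by
    refine memℓp_two_of_isBigO_pow (norm_nonneg _)
      (norm_zetaFn_lt_one (mem_cutPlane_of_im_pos hz)) ?_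
    have h1 := (jostSeq_isBigO hab ha (sq_ne_one_of_im_pos hz)).const_mul_left
      (polySolution a b z (n + 1) / omegaExt a b z)
    refine h1.congr' ?_ EventuallyEq.rfl
    filter_upwards [eventually_ge_atTop n] with m hm
    rw [greenSeq, min_eq_right (by omega), max_eq_left (by omega)]
    ring
  refine ⟨⟨_, hmem⟩, fun m => rfl, ?_⟩
  ext m
  have h1 := jacobiOperator_apply_of_shift (exists_bound_of_summable hab)
    (u := ⟨_, hmem⟩) (greenSeq_zero n) (fun m => rfl) m
  rw [lp.coeFn_sub, Pi.sub_apply, h1, basisVec_apply, ← greenSeq_equation hab ha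
    (sq_ne_one_of_im_pos hz) (omegaExt_ne_zero_of_im_pos hab ha hz) n m]
  rfl

theorem inner_poissonOp_basisVec (hab : Summable fun n => |a n - 1 / 2| + |b n|)
    (ha : ∀ n, 0 < a n) {l ε : ℝ} (hε : 0 < ε) (n m : ℕ) :
    inner ℂ (basisVec m) (poissonOp (jacobiOperator a b) ε l (basisVec n))
      = ((greenSeq a b (l + ε * Complex.I) n (m + 1)).im : ℂ) := by
  have hb := exists_bound_of_summable hab
  have hz : 0 < (l + ε * Complex.I : ℂ).im := by simpa using hε
  obtain ⟨v, hv, hHv⟩ := exists_resolvent_column hab ha hz n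
  -- The matrix is real, so the column at the conjugate point is the conjugate column.
  have hHv' : jacobiOperator a b (star v) - (l - ε * Complex.I : ℂ) • star v = basisVec n := by
    have h1 := congrArg star hHv
    rw [star_sub, star_smul, star_basisVec, ← jacobiOperator_star hb] at h1
    rw [← h1]
    congr 2
    simp [sub_eq_add_neg]
  rw [poissonOp_apply (isSelfAdjoint_jacobiOperator hb) hε hHv hHv', inner_smul_right,
    inner_basisVec_left, lp.coeFn_sub, Pi.sub_apply, lp.star_apply, hv]
  have h2 := Complex.sub_conj (greenSeq a b (l + ε * Complex.I) n (m + 1))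
  change 1 / (2 * Complex.I) * (_ - (starRingEnd ℂ) _) = _
  rw [h2]
  push_cast
  have := Complex.I_ne_zero
  field_simp

end GreenFunction

/-! ### Boundary values on the interval (-1, 1) -/

section BoundaryValues

variable {a b : ℕ → ℝ} {z : ℂ} {t : ℝ}

theorem SolvesJacobi.conj_ofReal {u : ℕ → ℂ} (hu : SolvesJacobi a b t u) :
    SolvesJacobi a b t fun n => (starRingEnd ℂ) (u n) := by
  intro n
  have := congrArg (starRingEnd ℂ) (hu n)
  simpa using this

/-- For real t both f and f̄ are solutions, and |ζ| = 1 cancels the powers of ζ. The constant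
Wronskian equals its limit (ζ̄ - ζ)/2 at infinity. -/
theorem wronskian_jostSeq_conj (hab : Summable fun n => |a n - 1 / 2| + |b n|)
    (ha : ∀ n, 0 < a n) (ht : t ∈ Ioo (-1 : ℝ) 1) :
    wronskian a (jostSeq a b (zetaFn t)) (fun n => (starRingEnd ℂ) (jostSeq a b (zetaFn t) n))
      = Complex.I * √(1 - t ^ 2) := by
  have hz := sq_ne_one_of_mem_upperRegion (ofReal_mem_upperRegion ht)
  obtain ⟨δ, hδ, hmem⟩ := mem_jostRegion (zetaFn_ne_zero t) (norm_zetaFn_le_one t)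
    (zetaFn_sq_ne_one hz)
  have hf := solvesJacobi_jostSeq_zetaFn hab ha hz
  have hg := tendsto_jostRatio hab ha hδ hmem
  have hζ := zetaFn_mul_conj_ofReal ht
  set ζ := zetaFn t with hζdef
  have h0 : ζ ≠ 0 := zetaFn_ne_zero t
  have hg1 : Tendsto (fun n => jostRatio a b ζ (n + 1)) atTop (𝓝 1) :=
    (tendsto_add_atTop_iff_nat 1).2 hg
  have hg2 : Tendsto (fun n => jostRatio a b ζ (n + 2)) atTop (𝓝 1) :=
    (tendsto_add_atTop_iff_nat 2).2 hg
  have hconj : ∀ {u : ℕ → ℂ}, Tendsto u atTop (𝓝 1) →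
      Tendsto (fun n => (starRingEnd ℂ) (u n)) atTop (𝓝 1) := fun hu => by
    have := (Complex.continuous_conj.tendsto 1).comp hu
    rwa [map_one] at this
  have key : ∀ n, wronskian a (jostSeq a b ζ) (fun n => (starRingEnd ℂ) (jostSeq a b ζ n))
      = a n * (jostRatio a b ζ (n + 1) * (starRingEnd ℂ) (jostRatio a b ζ (n + 2))
          * (starRingEnd ℂ) ζ
        - jostRatio a b ζ (n + 2) * (starRingEnd ℂ) (jostRatio a b ζ (n + 1)) * ζ) := by
    intro n
    rw [hf.wronskian_eq hf.conj_ofReal (n + 1)]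
    rw [show prevCoeff a (n + 1) = a n from rfl]
    have hpow : ζ ^ n * (starRingEnd ℂ) ζ ^ n = 1 := by rw [← mul_pow, hζ, one_pow]
    have h1 : ∀ k, jostSeq a b ζ (k + 1) = ζ ^ k * jostRatio a b ζ (k + 1) := by
      intro k
      rw [jostSeq, pow_succ]
      field_simp
    rw [h1, h1 (n + 1)]
    simp only [map_mul, map_pow, pow_succ]
    linear_combination (a n * (jostRatio a b ζ (n + 1)
      * (starRingEnd ℂ) (jostRatio a b ζ (n + 2)) * (starRingEnd ℂ) ζ
        - jostRatio a b ζ (n + 2) * (starRingEnd ℂ) (jostRatio a b ζ (n + 1)) * ζ)) * hpow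
  have hlim := (tendsto_ofReal_coeff hab).mul (((hg1.mul (hconj hg2)).mul_const
    ((starRingEnd ℂ) ζ)).sub ((hg2.mul (hconj hg1)).mul_const ζ))
  rw [tendsto_nhds_unique (tendsto_const_nhds.congr key) hlim]
  rw [hζdef, zetaFn_ofReal ht]
  simp only [map_sub, map_mul, Complex.conj_ofReal, Complex.conj_I]
  ring

theorem omegaExt_ne_zero (hab : Summable fun n => |a n - 1 / 2| + |b n|)
    (ha : ∀ n, 0 < a n) (hz : z ∈ upperRegion) : omegaExt a b z ≠ 0 := by
  rcases hz with hz | ⟨him, hre⟩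
  · exact omegaExt_ne_zero_of_im_pos hab ha hz
  obtain ⟨t, rfl⟩ : ∃ t : ℝ, z = t := ⟨z.re, Complex.ext rfl him⟩
  rw [Complex.ofReal_re] at hre
  intro h
  have hf := solvesJacobi_jostSeq_zetaFn hab ha
    (sq_ne_one_of_mem_upperRegion (ofReal_mem_upperRegion hre))
  have hP := solvesJacobi_polySolution a b ha (t : ℂ)
  have h0 : jostSeq a b (zetaFn t) 0 = 0 := by
    rw [omegaExt_eq] at h
    simpa using h
  have h1 := wronskian_jostSeq_conj hab ha hre
  rw [_root_.wronskian, h0] at h1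
  have h2 : (√(1 - t ^ 2) : ℂ) = 0 := by simpa using h1.symm
  have h3 := Real.sqrt_pos.2 (one_sub_sq_pos hre)
  exact h3.ne' (by exact_mod_cast h2)

theorem im_greenSeq_ofReal (hab : Summable fun n => |a n - 1 / 2| + |b n|)
    (ha : ∀ n, 0 < a n) (ht : t ∈ Ioo (-1 : ℝ) 1) (n m : ℕ) :
    (greenSeq a b t n (m + 1)).im
      = √(1 - t ^ 2) / (2 * ‖omegaExt a b t‖ ^ 2)
        * ((orthoPoly a b n).eval t * (orthoPoly a b m).eval t) := by
  have hz := ofReal_mem_upperRegion ht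
  have hω := omegaExt_ne_zero hab ha hz
  have hf := solvesJacobi_jostSeq_zetaFn hab ha (sq_ne_one_of_mem_upperRegion hz)
  have hP := solvesJacobi_polySolution a b ha (t : ℂ)
  have hW := wronskian_jostSeq_conj hab ha ht
  -- Evaluating {P, f} at index k and using that P is real, the terms with P_{k+1} cancel and P_k
  -- {f, f̄} remains.
  have h1 : ∀ k, jostSeq a b (zetaFn t) k * (starRingEnd ℂ) (omegaExt a b t)
      - (starRingEnd ℂ) (jostSeq a b (zetaFn t) k) * omegaExt a b t
      = polySolution a b t k * (Complex.I * √(1 - t ^ 2)) := by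
    intro k
    have e1 : omegaExt a b t = _ := hP.wronskian_eq hf k
    rw [← hW, hf.wronskian_eq hf.conj_ofReal k, e1]
    simp only [map_mul, map_sub, Complex.conj_ofReal, conj_polySolution_ofReal]
    ring
  have h2 : ∀ k, ((jostSeq a b (zetaFn t) k / omegaExt a b t).im : ℂ)
      = polySolution a b t k * (√(1 - t ^ 2) / (2 * ‖omegaExt a b t‖ ^ 2) : ℝ) := by
    intro k
    have hn : omegaExt a b t * (starRingEnd ℂ) (omegaExt a b t) = (‖omegaExt a b t‖ : ℂ) ^ 2 := by
      rw [Complex.mul_conj, Complex.normSq_eq_norm_sq]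
      push_cast
      rfl
    have hω' : (starRingEnd ℂ) (omegaExt a b t) ≠ 0 := (_root_.map_ne_zero _).2 hω
    have e1 := Complex.sub_conj (jostSeq a b (zetaFn t) k / omegaExt a b t)
    rw [map_div₀, div_sub_div _ _ hω hω', hn, mul_comm (omegaExt a b t), h1 k] at e1
    have hn0 : (‖omegaExt a b t‖ : ℂ) ≠ 0 := by simpa using hω
    have hI := Complex.I_ne_zero
    push_cast at e1 ⊢
    field_simp at e1 ⊢
    linear_combination -e1
  have h3 : greenSeq a b t n (m + 1) = polySolution a b t (min (m + 1) (n + 1))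
      * (jostSeq a b (zetaFn t) (max (m + 1) (n + 1)) / omegaExt a b t) := by
    rw [greenSeq, mul_div_assoc]
  rw [h3]
  rcases le_total m n with h | h
  · rw [min_eq_left (by omega), max_eq_right (by omega), polySolution_succ_ofReal,
      Complex.im_ofReal_mul]
    have h4 := h2 (n + 1)
    rw [polySolution_succ_ofReal, ← Complex.ofReal_mul] at h4
    rw [Complex.ofReal_injective h4]
    ring
  · rw [min_eq_right (by omega), max_eq_left (by omega), polySolution_succ_ofReal,
      Complex.im_ofReal_mul]
    have h4 := h2 (m + 1)
    rw [polySolution_succ_ofReal, ← Complex.ofReal_mul] at h4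
    rw [Complex.ofReal_injective h4]
    ring

theorem continuousOn_jostSeq_zetaFn (hab : Summable fun n => |a n - 1 / 2| + |b n|)
    (ha : ∀ n, 0 < a n) (k : ℕ) :
    ContinuousOn (fun z => jostSeq a b (zetaFn z) k) upperRegion := by
  intro z hz
  have h0 : 0 < ‖zetaFn z‖ := norm_pos_iff.2 (zetaFn_ne_zero z)
  have h1 : 0 < ‖1 - zetaFn z ^ 2‖ :=
    norm_pos_iff.2 (sub_ne_zero.2 (zetaFn_sq_ne_one (sq_ne_one_of_mem_upperRegion hz)).symm)
  -- The strict inequality keeps ζ(w) in the same `jostRegion δ` for all w near z in `upperRegion`.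
  obtain ⟨δ, hδ, hδ'⟩ := exists_between (lt_min h0 h1)
  have hc := continuousOn_zetaFn z hz
  have hc1 : ContinuousWithinAt (fun z => ‖1 - zetaFn z ^ 2‖) upperRegion z :=
    (continuousWithinAt_const.sub (hc.pow 2)).norm
  have htend : Tendsto zetaFn (𝓝[upperRegion] z) (𝓝[jostRegion δ] zetaFn z) := by
    refine tendsto_nhdsWithin_iff.2 ⟨hc, ?_⟩
    filter_upwards [hc.norm.eventually_const_lt (hδ'.trans_le (min_le_left _ _)),
      hc1.eventually_const_lt (hδ'.trans_le (min_le_right _ _))] with w h2 h3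
    exact ⟨h2.le, norm_zetaFn_le_one w, h3.le⟩
  have hmem : zetaFn z ∈ jostRegion δ :=
    ⟨(hδ'.trans_le (min_le_left _ _)).le, norm_zetaFn_le_one z,
      (hδ'.trans_le (min_le_right _ _)).le⟩
  exact (continuousOn_jostSeq hab ha hδ k (zetaFn z) hmem).tendsto.comp htend

theorem continuous_polySolution (k : ℕ) : Continuous fun z => polySolution a b z k :=
  Polynomial.continuous_aeval _

theorem continuousOn_omegaExt (hab : Summable fun n => |a n - 1 / 2| + |b n|)
    (ha : ∀ n, 0 < a n) : ContinuousOn (omegaExt a b) upperRegion :=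
  ((continuousOn_jostSeq_zetaFn hab ha 0).const_mul (-(1 / 2))).congr fun _ _ => omegaExt_eq

theorem continuousOn_greenSeq (hab : Summable fun n => |a n - 1 / 2| + |b n|)
    (ha : ∀ n, 0 < a n) (n k : ℕ) : ContinuousOn (fun z => greenSeq a b z n k) upperRegion :=
  ((continuous_polySolution _).continuousOn.mul (continuousOn_jostSeq_zetaFn hab ha _)).div
    (continuousOn_omegaExt hab ha) fun _ hz => omegaExt_ne_zero hab ha hz

theorem tendsto_jostFunction (hab : Summable fun n => |a n - 1 / 2| + |b n|)
    (ha : ∀ n, 0 < a n) (ht : t ∈ Ioo (-1 : ℝ) 1) :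
    Tendsto (jostFunction a b) (𝓝[{z : ℂ | 0 < z.im}] (t : ℂ))
      (𝓝 (-2 * zetaFn t * omegaExt a b t)) := by
  have hc : ContinuousWithinAt (fun z => -2 * zetaFn z * omegaExt a b z) {z : ℂ | 0 < z.im} t :=
    ((continuousOn_const.mul continuousOn_zetaFn).mul (continuousOn_omegaExt hab ha) _
      (ofReal_mem_upperRegion ht)).mono fun z hz => Or.inl hz
  refine hc.tendsto.congr' ?_
  filter_upwards [self_mem_nhdsWithin] with z hz
  rw [jostFunction, omegaFn, jostSolution_eq ha hab (mem_cutPlane_of_im_pos hz), omegaExt]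

theorem neBot_nhdsWithin_upperHalfPlane (t : ℝ) : (𝓝[{z : ℂ | 0 < z.im}] (t : ℂ)).NeBot := by
  rw [← mem_closure_iff_nhdsWithin_neBot, Complex.closure_setOfPred_lt_im]
  simp

theorem jostFunctionPlus_eq (hab : Summable fun n => |a n - 1 / 2| + |b n|)
    (ha : ∀ n, 0 < a n) (ht : t ∈ Ioo (-1 : ℝ) 1) :
    jostFunctionPlus a b t = -2 * zetaFn t * omegaExt a b t :=
  have := neBot_nhdsWithin_upperHalfPlane t
  (tendsto_jostFunction hab ha ht).limUnder_eq

theorem norm_jostFunctionPlus (hab : Summable fun n => |a n - 1 / 2| + |b n|)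
    (ha : ∀ n, 0 < a n) (ht : t ∈ Ioo (-1 : ℝ) 1) :
    ‖jostFunctionPlus a b t‖ = 2 * ‖omegaExt a b t‖ := by
  rw [jostFunctionPlus_eq hab ha ht]
  simp [norm_zetaFn_ofReal ht]

/-- A closed rectangle resting on [α, β] is compact in `upperRegion`, so G is bounded on it and
dominated convergence applies. -/
theorem integral_tendsto_boundary {G : ℂ → ℝ} (hG : ContinuousOn G upperRegion) {α β : ℝ}
    (hα : α ∈ Ioo (-1 : ℝ) 1) (hβ : β ∈ Ioo (-1 : ℝ) 1) :
    Tendsto (fun ε : ℝ => ∫ l in α..β, G (l + ε * Complex.I)) (𝓝[>] 0)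
      (𝓝 (∫ l in α..β, G l)) := by
  have hsub : uIcc α β ⊆ Ioo (-1 : ℝ) 1 := ordConnected_Ioo.uIcc_subset hα hβ
  have hmaps : ∀ l ∈ uIcc α β, ∀ ε : ℝ, 0 ≤ ε → (l + ε * Complex.I : ℂ) ∈ upperRegion := by
    intro l hl ε hε
    rcases hε.eq_or_lt with rfl | hε
    · simpa using ofReal_mem_upperRegion (hsub hl)
    · exact Or.inl (by simpa using hε)
  have hcomp : IsCompact ((fun p : ℝ × ℝ => (p.1 + p.2 * Complex.I : ℂ)) ''
      (uIcc α β ×ˢ Icc 0 1)) :=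
    (isCompact_uIcc.prod isCompact_Icc).image (by fun_prop)
  obtain ⟨M, hM⟩ := hcomp.exists_bound_of_continuousOn (f := G) (hG.mono (by
    rintro _ ⟨p, hp, rfl⟩
    exact hmaps p.1 hp.1 p.2 hp.2.1))
  refine intervalIntegral.tendsto_integral_filter_of_dominated_convergence (fun _ => M) ?_ ?_
    (by simp) ?_
  · filter_upwards [self_mem_nhdsWithin] with ε hε
    have hc : ContinuousOn (fun l : ℝ => G (l + ε * Complex.I)) (uIcc α β) :=
      hG.comp (f := fun l : ℝ => (l + ε * Complex.I : ℂ)) (by fun_prop)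
        fun l hl => hmaps l hl ε (le_of_lt hε)
    exact (hc.mono uIoc_subset_uIcc).aestronglyMeasurable measurableSet_uIoc
  · filter_upwards [Ioo_mem_nhdsGT zero_lt_one] with ε hε
    exact ae_of_all _ fun l hl => hM _ ⟨(l, ε), ⟨uIoc_subset_uIcc hl, hε.1.le, hε.2.le⟩, rfl⟩
  · refine ae_of_all _ fun l hl => ?_
    have hl' := uIoc_subset_uIcc hl
    have h1 : Tendsto (fun ε : ℝ => (l + ε * Complex.I : ℂ)) (𝓝[>] 0) (𝓝[upperRegion] l) := by
      refine tendsto_nhdsWithin_iff.2 ⟨?_, ?_⟩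
      · have : Continuous fun ε : ℝ => (l + ε * Complex.I : ℂ) := by fun_prop
        have h2 := this.tendsto 0
        rw [Complex.ofReal_zero, zero_mul, add_zero] at h2
        exact h2.mono_left nhdsWithin_le_nhds
      · filter_upwards [self_mem_nhdsWithin] with ε hε
        exact hmaps l hl' ε (le_of_lt hε)
    exact (hG l (ofReal_mem_upperRegion (hsub hl'))).tendsto.comp h1

end BoundaryValues

/-! ### Spectral density of the Jacobi operator -/

section JacobiSpectralDensity

variable (a b : ℕ → ℝ)

/-- The weight function `w(t) = (2/π) √(1 - t²) |Ω(t + i0)|⁻²`. -/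
def jostWeight (t : ℝ) : ℝ := 2 / Real.pi * √(1 - t ^ 2) * (‖jostFunctionPlus a b t‖ ^ 2)⁻¹

/-- The imaginary part of the quadratic form of the resolvent at the vector `e_n + c e_m`. -/
def greenForm (n m : ℕ) (c : ℂ) (z : ℂ) : ℝ :=
  (greenSeq a b z n (n + 1)).im + c.re * ((greenSeq a b z m (n + 1)).im
    + (greenSeq a b z n (m + 1)).im) + ‖c‖ ^ 2 * (greenSeq a b z m (m + 1)).im

variable {a b} {t : ℝ}

theorem greenForm_ofReal (hab : Summable fun n => |a n - 1 / 2| + |b n|)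
    (ha : ∀ n, 0 < a n) (ht : t ∈ Ioo (-1 : ℝ) 1) (n m : ℕ) (c : ℂ) :
    greenForm a b n m c t / Real.pi = jostWeight a b t * ((orthoPoly a b n).eval t ^ 2
      + 2 * c.re * ((orthoPoly a b n).eval t * (orthoPoly a b m).eval t)
      + ‖c‖ ^ 2 * (orthoPoly a b m).eval t ^ 2) := by
  have h0 : ‖omegaExt a b t‖ ≠ 0 :=
    norm_ne_zero_iff.2 (omegaExt_ne_zero hab ha (ofReal_mem_upperRegion ht))
  have hp := Real.pi_ne_zero
  simp only [greenForm, im_greenSeq_ofReal hab ha ht, jostWeight, norm_jostFunctionPlus hab ha ht]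
  field_simp
  ring

theorem jostWeight_nonneg (t : ℝ) : 0 ≤ jostWeight a b t := by
  unfold jostWeight
  positivity

theorem continuousOn_greenForm (hab : Summable fun n => |a n - 1 / 2| + |b n|)
    (ha : ∀ n, 0 < a n) (n m : ℕ) (c : ℂ) : ContinuousOn (greenForm a b n m c) upperRegion := by
  have h : ∀ n k, ContinuousOn (fun z => (greenSeq a b z n k).im) upperRegion := fun n k =>
    Complex.continuous_im.comp_continuousOn (continuousOn_greenSeq hab ha n k)
  exact ((h _ _).add (continuousOn_const.mul ((h _ _).add (h _ _)))).add
    (continuousOn_const.mul (h _ _))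

theorem continuousOn_greenForm_ofReal (hab : Summable fun n => |a n - 1 / 2| + |b n|)
    (ha : ∀ n, 0 < a n) (n m : ℕ) (c : ℂ) :
    ContinuousOn (fun t : ℝ => greenForm a b n m c t / Real.pi) (Ioo (-1) 1) :=
  ((continuousOn_greenForm hab ha n m c).comp (f := fun t : ℝ => (t : ℂ)) (by fun_prop)
    fun _ ht => ofReal_mem_upperRegion ht).div_const _

theorem re_inner_poissonOp (hab : Summable fun n => |a n - 1 / 2| + |b n|)
    (ha : ∀ n, 0 < a n) (n m : ℕ) (c : ℂ) {ε : ℝ} (hε : 0 < ε) (l : ℝ) :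
    (inner ℂ (basisVec n + c • basisVec m)
      (poissonOp (jacobiOperator a b) ε l (basisVec n + c • basisVec m))).re
      = greenForm a b n m c (l + ε * Complex.I) := by
  rw [map_add, map_smul, inner_add_left, inner_add_right, inner_add_right, inner_smul_left,
    inner_smul_left, inner_smul_right, inner_smul_right]
  simp only [inner_poissonOp_basisVec hab ha hε]
  rw [← mul_assoc, ← Complex.normSq_eq_conj_mul_self, Complex.normSq_eq_norm_sq]
  simp only [Complex.add_re, Complex.re_mul_ofReal, Complex.ofReal_re,
    Complex.conj_re, greenForm]
  ring

theorem spectralFamily_jacobi_increment (hab : Summable fun n => |a n - 1 / 2| + |b n|)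
    (ha : ∀ n, 0 < a n) (n m : ℕ) (c : ℂ) (α : ℝ) (hα : α ∈ Ioo (-1 : ℝ) 1) (β : ℝ)
    (hβ : β ∈ Ioo (-1 : ℝ) 1) (h : α ≤ β) :
    (inner ℂ (basisVec n + c • basisVec m)
      (spectralFamily (jacobiOperator a b) β (basisVec n + c • basisVec m))).re
    - (inner ℂ (basisVec n + c • basisVec m)
      (spectralFamily (jacobiOperator a b) α (basisVec n + c • basisVec m))).re
      = ∫ l in α..β, greenForm a b n m c l / Real.pi := by
  refine spectralFamily_increment (isSelfAdjoint_jacobiOperator (exists_bound_of_summable hab))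
    (continuousOn_greenForm_ofReal hab ha n m c) (fun α hα β hβ _ => ?_) hα hβ h
  rw [intervalIntegral.integral_div, mul_div_cancel₀ _ Real.pi_ne_zero]
  refine (integral_tendsto_boundary (continuousOn_greenForm hab ha n m c) hα hβ).congr' ?_
  filter_upwards [self_mem_nhdsWithin] with ε hε
  exact intervalIntegral.integral_congr fun l _ => (re_inner_poissonOp hab ha n m c hε l).symm

theorem hasDerivAt_spectralFamily_quadratic (hab : Summable fun n => |a n - 1 / 2| + |b n|)
    (ha : ∀ n, 0 < a n) (ht : t ∈ Ioo (-1 : ℝ) 1) (n m : ℕ) (c : ℂ) :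
    HasDerivAt (fun s => (inner ℂ (basisVec n + c • basisVec m)
      (spectralFamily (jacobiOperator a b) s (basisVec n + c • basisVec m))).re)
      (jostWeight a b t * ((orthoPoly a b n).eval t ^ 2
      + 2 * c.re * ((orthoPoly a b n).eval t * (orthoPoly a b m).eval t)
      + ‖c‖ ^ 2 * (orthoPoly a b m).eval t ^ 2)) t := by
  rw [← greenForm_ofReal hab ha ht]
  exact hasDerivAt_of_increment (continuousOn_greenForm_ofReal hab ha n m c)
    (spectralFamily_jacobi_increment hab ha n m c) ht

theorem inner_spectralFamily_self {E : Type*} [NormedAddCommGroup E] [InnerProductSpace ℂ E]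
    [CompleteSpace E] (T : E →L[ℂ] E) (s : ℝ) (x : E) :
    inner ℂ (spectralFamily T s x) x = ((inner ℂ x (spectralFamily T s x)).re : ℂ) := by
  have h : inner ℂ (spectralFamily T s x) x = inner ℂ x (spectralFamily T s x) :=
    ContinuousLinearMap.isSelfAdjoint_iff_isSymmetric.1 (isSelfAdjoint_spectralFamily T s) x x
  rw [h]
  refine (Complex.conj_eq_iff_re.1 ?_).symm
  rw [inner_conj_symm, h]

/-- All four vectors have the form x + c y, so one derivative formula for `basisVec n + c • basisVec
m` covers every matrix element. -/
theorem inner_spectralFamily_polarization {E : Type*} [NormedAddCommGroup E]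
    [InnerProductSpace ℂ E] [CompleteSpace E] (T : E →L[ℂ] E) (s : ℝ) (x y : E) :
    inner ℂ y (spectralFamily T s x) =
      ((((inner ℂ (x + (1 : ℂ) • y) (spectralFamily T s (x + (1 : ℂ) • y))).re : ℝ) : ℂ)
      - ((inner ℂ (x + (-1 : ℂ) • y) (spectralFamily T s (x + (-1 : ℂ) • y))).re : ℝ)
      + Complex.I * ((inner ℂ (x + Complex.I • y)
          (spectralFamily T s (x + Complex.I • y))).re : ℝ)
      - Complex.I * ((inner ℂ (x + (-Complex.I) • y)
          (spectralFamily T s (x + (-Complex.I) • y))).re : ℝ)) / 4 := by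
  have h : inner ℂ (spectralFamily T s y) x = inner ℂ y (spectralFamily T s x) :=
    ContinuousLinearMap.isSelfAdjoint_iff_isSymmetric.1 (isSelfAdjoint_spectralFamily T s) y x
  have hp := inner_map_polarization (spectralFamily T s).toLinearMap x y
  simp only [ContinuousLinearMap.coe_coe] at hp
  rw [← h, hp]
  simp only [← inner_spectralFamily_self, one_smul, neg_smul, ← sub_eq_add_neg]

theorem hasDerivAt_inner_spectralFamily (hab : Summable fun n => |a n - 1 / 2| + |b n|)
    (ha : ∀ n, 0 < a n) (ht : t ∈ Ioo (-1 : ℝ) 1) (n m : ℕ) :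
    HasDerivAt
      (fun s : ℝ => inner ℂ (basisVec m) (spectralFamily (jacobiOperator a b) s (basisVec n)))
      ((jostWeight a b t * (orthoPoly a b n).eval t * (orthoPoly a b m).eval t : ℝ) : ℂ) t := by
  have hd := fun c => (hasDerivAt_spectralFamily_quadratic hab ha ht n m c).ofReal_comp
  -- All c have modulus 1, so the diagonal terms cancel in pairs; the cross term 2 Re c survives
  -- only for c = ±1 and adds up to 4 P_n P_m times the weight.
  have h := ((((hd 1).sub (hd (-1))).add ((hd Complex.I).const_mul Complex.I)).sub
    ((hd (-Complex.I)).const_mul Complex.I)).div_const 4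
  refine (h.congr_deriv ?_).congr_of_eventuallyEq
    (Eventually.of_forall fun s => inner_spectralFamily_polarization _ _ _ _)
  simp
  ring

theorem spectralMeasure_basisVec (hab : Summable fun n => |a n - 1 / 2| + |b n|)
    (ha : ∀ n, 0 < a n) (n : ℕ) :
    (spectralMeasure (jacobiOperator a b) (basisVec n)).restrict (Ioo (-1) 1)
      = (volume.restrict (Ioo (-1) 1)).withDensity fun t =>
        ENNReal.ofReal (jostWeight a b t * (orthoPoly a b n).eval t ^ 2) := by
  have heq : ∀ t ∈ Ioo (-1 : ℝ) 1, greenForm a b n n 0 t / Real.pi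
      = jostWeight a b t * (orthoPoly a b n).eval t ^ 2 := fun t ht => by
    rw [greenForm_ofReal hab ha ht]
    simp
  have h := restrict_measure_stieltjes_eq_withDensity
    (spectralFamily_mono (jacobiOperator a b) (basisVec n)) (by norm_num : (-1 : ℝ) < 1)
    (continuousOn_greenForm_ofReal hab ha n n 0)
    (fun t ht => by
      rw [heq t ht]
      exact mul_nonneg (jostWeight_nonneg t) (sq_nonneg _))
    (fun α hα β hβ hαβ => by
      simpa using spectralFamily_jacobi_increment hab ha n n 0 α hα β hβ hαβ)
  refine h.trans (withDensity_congr_ae ?_)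
  filter_upwards [ae_restrict_mem measurableSet_Ioo] with t ht
  rw [heq t ht]

theorem isSpectrallyACOn_jacobiOperator (hab : Summable fun n => |a n - 1 / 2| + |b n|)
    (ha : ∀ n, 0 < a n) : IsSpectrallyACOn (jacobiOperator a b) (Ioo (-1) 1) := by
  refine isSpectrallyACOn_of_dense _ measurableSet_Ioo (range basisVec) span_basisVec_dense ?_
  rintro _ ⟨n, rfl⟩
  rw [spectralMeasure_basisVec hab ha n]
  exact (withDensity_absolutelyContinuous _ _).trans Measure.restrict_le_self.absolutelyContinuous

theorem spectralMeasure_basisVec_zero (hab : Summable fun n => |a n - 1 / 2| + |b n|)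
    (ha : ∀ n, 0 < a n) :
    (spectralMeasure (jacobiOperator a b) (basisVec 0)).restrict (Ioo (-1) 1)
      = (volume.restrict (Ioo (-1) 1)).withDensity fun t => ENNReal.ofReal (jostWeight a b t) := by
  rw [spectralMeasure_basisVec hab ha 0]
  simp [orthoPoly, orthoPolyAux]

/-- All defects vanish, so `jostVec` is identically (1, 0), f_{-1} = ζ⁻¹ and |ω| = 1/2. -/
theorem norm_jostFunctionPlus_free (ht : t ∈ Ioo (-1 : ℝ) 1) :
    ‖jostFunctionPlus (fun _ => 1 / 2) (fun _ => 0) t‖ = 1 := by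
  have hab : Summable fun _ : ℕ => |(1 / 2 : ℝ) - 1 / 2| + |(0 : ℝ)| := by simp
  have ha : ∀ _ : ℕ, (0 : ℝ) < 1 / 2 := fun _ => by norm_num
  obtain ⟨δ, hδ, hmem⟩ := mem_jostRegion (zetaFn_ne_zero t) (norm_zetaFn_le_one t)
    (zetaFn_sq_ne_one (sq_ne_one_of_mem_upperRegion (ofReal_mem_upperRegion ht)))
  have hp := (isSummablePerturbation_jostStep (a := fun _ => 1 / 2) (b := fun _ => 0) hab
    (by norm_num : (0 : ℝ) < 1 / 2) (fun _ => le_rfl) hδ hmem).norm_backSol_sub_le 0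
  have hs : ∀ k, stepDefect (fun _ => 1 / 2) (fun _ => 0) k = 0 := by
    intro k
    cases k <;> simp [stepDefect, prevCoeff]
  simp only [hs, mul_zero, tsum_zero] at hp
  have hv : jostVec (fun _ => 1 / 2) (fun _ => 0) (zetaFn t) 0 = (1, 0) :=
    sub_eq_zero.1 (norm_le_zero_iff.1 hp)
  rw [norm_jostFunctionPlus hab ha ht, omegaExt_eq, jostSeq, jostRatio, hv]
  simp [norm_zetaFn_ofReal ht]

end JacobiSpectralDensity

end

/-- Absolute continuity, spectral family and weight function of a Jacobi operator that is a
trace-class perturbation of the free one. The first two clauses say that the Jost function and its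
boundary values, in terms of which the formulas are written, exist and that the formulas do not
divide by zero. -/
theorem theorem2p7 (a b : ℕ → ℝ) (ha : ∀ n, 0 < a n)
    (hab : Summable fun n => |a n - 1 / 2| + |b n|) :
    (∀ z ∈ cutPlane, ∃! f : ℕ → ℂ, IsJostSolution a b z f) ∧
    (∀ t ∈ Set.Ioo (-1 : ℝ) 1,
      Tendsto (jostFunction a b) (𝓝[{z : ℂ | 0 < z.im}] (t : ℂ)) (𝓝 (jostFunctionPlus a b t)) ∧
      jostFunctionPlus a b t ≠ 0) ∧
    IsSpectrallyACOn (jacobiOperator a b) (Set.Ioo (-1) 1) ∧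
    (∀ n m : ℕ, ∀ t ∈ Set.Ioo (-1 : ℝ) 1,
      HasDerivAt
        (fun s : ℝ =>
          inner ℂ (basisVec m) (spectralFamily (jacobiOperator a b) s (basisVec n)))
        ((2 / Real.pi * √(1 - t ^ 2) * (‖jostFunctionPlus a b t‖ ^ 2)⁻¹ *
          (orthoPoly a b n).eval t * (orthoPoly a b m).eval t : ℝ) : ℂ) t) ∧
    (spectralMeasure (jacobiOperator a b) (basisVec 0)).restrict (Set.Ioo (-1) 1) =
      (volume.restrict (Set.Ioo (-1) 1)).withDensity (fun t =>
        ENNReal.ofReal (2 / Real.pi * √(1 - t ^ 2) * (‖jostFunctionPlus a b t‖ ^ 2)⁻¹)) ∧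
    (spectralMeasure (jacobiOperator (fun _ => 1 / 2) (fun _ => 0)) (basisVec 0)).restrict
        (Set.Ioo (-1) 1) =
      (volume.restrict (Set.Ioo (-1) 1)).withDensity (fun t =>
        ENNReal.ofReal (2 / Real.pi * √(1 - t ^ 2))) := by
  have hfree : Summable fun _ : ℕ => |(1 / 2 : ℝ) - 1 / 2| + |(0 : ℝ)| := by simp
  refine ⟨fun z hz => existsUnique_isJostSolution ha hab hz, fun t ht => ?_,
    isSpectrallyACOn_jacobiOperator hab ha,
    fun n m t ht => hasDerivAt_inner_spectralFamily hab ha ht n m,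
    spectralMeasure_basisVec_zero hab ha, ?_⟩
  · have h := jostFunctionPlus_eq hab ha ht
    refine ⟨h ▸ tendsto_jostFunction hab ha ht, ?_⟩
    rw [h]
    exact mul_ne_zero (mul_ne_zero (by norm_num) (zetaFn_ne_zero _))
      (omegaExt_ne_zero hab ha (ofReal_mem_upperRegion ht))
  · rw [spectralMeasure_basisVec_zero hfree fun _ => by norm_num]
    refine withDensity_congr_ae ?_
    filter_upwards [ae_restrict_mem measurableSet_Ioo] with t ht
    rw [jostWeight, norm_jostFunctionPlus_free ht]
    simp
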